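/- Let $n\ge 1$ and let $\Bbbk$ be a field. All manifolds are smooth and oriented. An $n$-dimensional TQFT over $\Bbbk$ is a symmetric monoidal functor from the $n$-dimensional oriented cobordism category (objects: closed $(n-1)$-manifolds; morphisms: compact $n$-dimensional cobordisms up to orientation-preserving diffeomorphism compatible with the boundary diffeomorphisms; composition: gluing; monoidal structure: disjoint union) to $\Bbbk$-vector spaces. Let $\mathbf{nTQFT}^\times_{\Bbbk}$ be the group, under tensor product, of monoidal isomorphism classes of those TQFTs $\mathcal T$ for which there is a TQFT $\mathcal T'$ with $\mathcal T\otimes\mathcal T'$ isomorphic to the trivial TQFT. Let $\mathbb M_n$ be the commutative monoid, under disjoint union, of closed $n$-manifolds up to orientation-preserving diffeomorphism, and let $SKK_n$ be the quotient of its Grothendieck group by the subgroup generated by all elements $[M]-[N]-[M']+[N']$ with $$M=X_1\cup_f X_2,\quad N=X_1\cup_g X_2,\quad M'=Y_1\cup_f Y_2,\quad N'=Y_1\cup_g Y_2,$$ where $\Sigma$ is a closed $(n-1)$-manifold, $X_1,Y_1:\emptyset\rightsquigarrow\Sigma$ and $X_2,Y_2:\Sigma\rightsquigarrow\emptyset$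 are cobordisms, and $f,g:\Sigma\to\Sigma$ are orientation-preserving diffeomorphisms. Let $\delta:\operatorname{Hom}_{\Bbbk}(\Bbbk,\Bbbk)\to\Bbbk$ be the canonical isomorphism $\varphi\mapsto\varphi(1)$, and identify $\mathcal T(\emptyset)$ with $\Bbbk$ for each TQFT $\mathcal T$. Theorem. There is exactly one group homomorphism $$\Psi_n:\mathbf{nTQFT}^\times_{\Bbbk}\to\operatorname{Hom}(SKK_n,\Bbbk^\times)$$ with $\Psi_n(\mathcal T)([X])=\delta(\mathcal T(X))$ for every invertible TQFT $\mathcal T$ and every closed $n$-manifold $X$, regarded as a cobordism $\emptyset\rightsquigarrow\emptyset$. Let $\mathscr T^n_{\Bbbk}$ be the subgroup of $\mathbf{nTQFT}^\times_{\Bbbk}$ that consists of all $\mathcal T$ such that $\mathcal T(M)=\mathrm{id}$ for all $n$-cobordisms $M:\emptyset\rightsquigarrow\emptyset$, that is, for all $n$-cobordisms with empty boundary. Then $$\mathscr T^n_{\Bbbk}=\ker(\Psi_n).$$ -/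

import Mathlib

open scoped Manifold ContDiff TensorProduct Topology

universe u

namespace InvertibleTQFT

noncomputable section

/-! ### Compact oriented smooth manifolds -/

/-- The sign (`1`, `-1`, or `0` for a linearly dependent family) of a family of `n` vectors with
respect to an orientation; `someVector` is any alternating form representing the orientation. -/
def orientSign {V : Type*} [AddCommGroup V] [Module ℝ V] {n : ℕ}
    (o : Orientation ℝ V (Fin n)) (v : Fin n → V) : SignType :=
  SignType.sign (o.someVector v)

/-- Compact oriented smooth `n`-manifolds (not necessarily connected, possibly empty), modelled on
`I`. An orientation is a choice of orientation of each tangent space that is locally constant. Here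
`TangentSpace I y` is identified with `ℝⁿ` through the preferred chart at `y`, so that
`tangentCoordChange I y x y` expresses tangent vectors at `y` in the preferred chart at `x`. -/
structure CompactOriented {n : ℕ} {H : Type} [TopologicalSpace H]
    (I : ModelWithCorners ℝ (EuclideanSpace ℝ (Fin n)) H) where
  carrier : Type
  [topologicalSpace : TopologicalSpace carrier]
  [chartedSpace : ChartedSpace H carrier]
  [isManifold : IsManifold I ∞ carrier]
  [compactSpace : CompactSpace carrier]
  [t2Space : T2Space carrier]
  orient : ∀ x : carrier, Orientation ℝ (TangentSpace I x) (Fin n)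
  orient_locally_constant : ∀ x : carrier, ∀ᶠ y in 𝓝 x, ∀ v : Fin n → TangentSpace I y,
    orientSign (orient x) (fun i => tangentCoordChange I y x y (v i)) = orientSign (orient y) v

attribute [instance] CompactOriented.topologicalSpace CompactOriented.chartedSpace
  CompactOriented.isManifold CompactOriented.compactSpace CompactOriented.t2Space

instance {n : ℕ} {H : Type} [TopologicalSpace H]
    (I : ModelWithCorners ℝ (EuclideanSpace ℝ (Fin n)) H) :
    CoeSort (CompactOriented I) Type := ⟨CompactOriented.carrier⟩

section Manifolds

variable {n : ℕ} {H : Type} [TopologicalSpace H]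
  {I : ModelWithCorners ℝ (EuclideanSpace ℝ (Fin n)) H}

/-- Smooth maps (between manifolds of the same dimension) that preserve the orientation. In
particular the differential is invertible at each point. -/
def OrientationPreserving (M N : CompactOriented I) (f : M → N) : Prop :=
  ContMDiff I I ∞ f ∧ ∀ (x : M) (v : Fin n → TangentSpace I x),
    orientSign (N.orient (f x)) (fun i => mfderiv I I f x (v i)) = orientSign (M.orient x) v

/-- `M` and `N` are diffeomorphic through an orientation preserving diffeomorphism. -/
def OrientedDiffeomorphic (M N : CompactOriented I) : Prop :=
  ∃ f : Diffeomorph I I M N ∞, OrientationPreserving M N f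

/-- The empty manifold. -/
def CompactOriented.empty (I : ModelWithCorners ℝ (EuclideanSpace ℝ (Fin n)) H) :
    CompactOriented I :=
  letI : ChartedSpace H Empty := ChartedSpace.empty H Empty
  { carrier := Empty
    orient := fun x => x.elim
    orient_locally_constant := fun x => x.elim }

instance : IsEmpty (CompactOriented.empty I) := inferInstanceAs (IsEmpty Empty)

lemma tangentCoordChange_inl {M N : Type} [TopologicalSpace M] [ChartedSpace H M]
    [IsManifold I ∞ M] [TopologicalSpace N] [ChartedSpace H N] [IsManifold I ∞ N] (x y : M) :
    tangentCoordChange I (Sum.inl y : M ⊕ N) (Sum.inl x) (Sum.inl y) =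
      tangentCoordChange I y x y := by
  rw [tangentCoordChange_def, tangentCoordChange_def]
  have h1 : extChartAt I (Sum.inl x : M ⊕ N) ∘ (extChartAt I (Sum.inl y : M ⊕ N)).symm =
      extChartAt I x ∘ (extChartAt I y).symm := by
    funext z
    simp [extChartAt, ChartedSpace.sum_chartAt_inl, Sum.inl_injective.extend_apply]
  have h2 : extChartAt I (Sum.inl y : M ⊕ N) (Sum.inl y) = extChartAt I y y := by
    simp [extChartAt]
  rw [h1, h2]

lemma tangentCoordChange_inr {M N : Type} [TopologicalSpace M] [ChartedSpace H M]
    [IsManifold I ∞ M] [TopologicalSpace N] [ChartedSpace H N] [IsManifold I ∞ N] (x y : N) :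
    tangentCoordChange I (Sum.inr y : M ⊕ N) (Sum.inr x) (Sum.inr y) =
      tangentCoordChange I y x y := by
  rw [tangentCoordChange_def, tangentCoordChange_def]
  have h1 : extChartAt I (Sum.inr x : M ⊕ N) ∘ (extChartAt I (Sum.inr y : M ⊕ N)).symm =
      extChartAt I x ∘ (extChartAt I y).symm := by
    funext z
    simp [extChartAt, ChartedSpace.sum_chartAt_inr, Sum.inr_injective.extend_apply]
  have h2 : extChartAt I (Sum.inr y : M ⊕ N) (Sum.inr y) = extChartAt I y y := by
    simp [extChartAt]
  rw [h1, h2]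

/-- The disjoint union `M ⊔ N`. -/
def CompactOriented.sum (M N : CompactOriented I) : CompactOriented I where
  carrier := M ⊕ N
  orient p := match p with
    | .inl x => M.orient x
    | .inr y => N.orient y
  orient_locally_constant p := by
    rcases p with x | x
    · rw [(Topology.IsOpenEmbedding.inl (X := M) (Y := N)).map_nhds_eq x |>.symm,
        Filter.eventually_map]
      filter_upwards [M.orient_locally_constant x] with y hy v
      rw [tangentCoordChange_inl]
      exact hy v
    · rw [(Topology.IsOpenEmbedding.inr (X := M) (Y := N)).map_nhds_eq x |>.symm,
        Filter.eventually_map]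
      filter_upwards [N.orient_locally_constant x] with y hy v
      rw [tangentCoordChange_inr]
      exact hy v

/-! Orientation preserving maps: identity, composition, disjoint unions. -/

lemma OrientationPreserving.id (M : CompactOriented I) :
    OrientationPreserving M M (fun x => x) :=
  ⟨contMDiff_id, fun x v => by
    have : mfderiv I I (fun x : M => x) x = ContinuousLinearMap.id ℝ _ := mfderiv_id
    rw [this]; rfl⟩

lemma OrientationPreserving.comp {M N P : CompactOriented I} {g : N → P} {f : M → N}
    (hg : OrientationPreserving N P g) (hf : OrientationPreserving M N f) :
    OrientationPreserving M P (g ∘ f) :=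
  ⟨hg.1.comp hf.1, fun x v => by
    rw [mfderiv_comp x ((hg.1 _).mdifferentiableAt (by simp))
      ((hf.1 _).mdifferentiableAt (by simp))]
    exact (hg.2 (f x) _).trans (hf.2 x v)⟩

lemma OrientationPreserving.inl (M N : CompactOriented I) :
    OrientationPreserving M (M.sum N) Sum.inl :=
  ⟨ContMDiff.inl, fun x v => by
    have : mfderiv I I (Sum.inl : M → M ⊕ N) x = ContinuousLinearMap.id ℝ _ :=
      mfderiv_sumInl (p := (Sum.inl x : M ⊕ N))
    erw [this]; rfl⟩

lemma OrientationPreserving.inr (M N : CompactOriented I) :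
    OrientationPreserving N (M.sum N) Sum.inr :=
  ⟨ContMDiff.inr, fun x v => by
    have : mfderiv I I (Sum.inr : N → M ⊕ N) x = ContinuousLinearMap.id ℝ _ :=
      mfderiv_sumInr
    erw [this]; rfl⟩

lemma OrientationPreserving.of_sum {M N P : CompactOriented I} {f : M.sum N → P}
    (h : ContMDiff I I ∞ f)
    (h1 : OrientationPreserving M P (f ∘ Sum.inl)) (h2 : OrientationPreserving N P (f ∘ Sum.inr)) :
    OrientationPreserving (M.sum N) P f := by
  refine ⟨h, fun p v => ?_⟩
  rcases p with x | x
  · have e' := mfderiv_comp (g := f) (f := (Sum.inl : M → M.sum N)) x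
      ((h _).mdifferentiableAt (by simp))
      (((OrientationPreserving.inl M N).1 x).mdifferentiableAt (by simp))
    have e2 : mfderiv I I (Sum.inl : M → M ⊕ N) x = ContinuousLinearMap.id ℝ _ :=
      mfderiv_sumInl (p := (Sum.inl x : M ⊕ N))
    have e3 : mfderiv I I (f ∘ Sum.inl) x = mfderiv I I f (Sum.inl x) := by
      erw [e', e2]; rfl
    have e := h1.2 x v
    rw [e3] at e
    exact e
  · have e' := mfderiv_comp (g := f) (f := (Sum.inr : N → M.sum N)) x
      ((h _).mdifferentiableAt (by simp))
      (((OrientationPreserving.inr M N).1 x).mdifferentiableAt (by simp))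
    have e2 : mfderiv I I (Sum.inr : N → M ⊕ N) x = ContinuousLinearMap.id ℝ _ :=
      mfderiv_sumInr
    have e3 : mfderiv I I (f ∘ Sum.inr) x = mfderiv I I f (Sum.inr x) := by
      erw [e', e2]; rfl
    have e := h2.2 x v
    rw [e3] at e
    exact e

lemma OrientedDiffeomorphic.refl (M : CompactOriented I) : OrientedDiffeomorphic M M :=
  ⟨Diffeomorph.refl I M ∞, OrientationPreserving.id M⟩

lemma OrientedDiffeomorphic.trans {M N P : CompactOriented I} :
    OrientedDiffeomorphic M N → OrientedDiffeomorphic N P → OrientedDiffeomorphic M P :=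
  fun ⟨f, hf⟩ ⟨g, hg⟩ => ⟨f.trans g, hg.comp hf⟩

lemma OrientedDiffeomorphic.symm {M N : CompactOriented I} :
    OrientedDiffeomorphic M N → OrientedDiffeomorphic N M := by
  rintro ⟨f, hf⟩
  refine ⟨f.symm, f.symm.contMDiff, fun y v => ?_⟩
  have hd : (mfderiv I I f (f.symm y)).comp (mfderiv I I f.symm y) =
      ContinuousLinearMap.id ℝ (EuclideanSpace ℝ (Fin n)) := by
    have e := mfderiv_comp y ((f.contMDiff (f.symm y)).mdifferentiableAt (by simp))
      ((f.symm.contMDiff y).mdifferentiableAt (by simp))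
    have e2 : (f ∘ f.symm : N → N) = fun y => y := by funext z; simp
    rw [e2] at e
    exact e.symm.trans mfderiv_id
  have e := hf.2 (f.symm y) (fun i => mfderiv I I f.symm y (v i))
  have e3 : (fun i => mfderiv I I f (f.symm y) (mfderiv I I f.symm y (v i))) = v := by
    funext i
    exact congrArg (fun L => L (v i)) hd
  rw [← e]
  erw [e3]
  have key : ∀ z : N, z = y → ∀ w : Fin n → EuclideanSpace ℝ (Fin n),
      orientSign (V := EuclideanSpace ℝ (Fin n)) (N.orient z) w =
      orientSign (V := EuclideanSpace ℝ (Fin n)) (N.orient y) w := by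
    rintro z rfl w; rfl
  exact key _ (f.apply_symm_apply y) v

lemma OrientedDiffeomorphic.sum_congr {M M' N N' : CompactOriented I} :
    OrientedDiffeomorphic M M' → OrientedDiffeomorphic N N' →
      OrientedDiffeomorphic (M.sum N) (M'.sum N') :=
  fun ⟨f, hf⟩ ⟨g, hg⟩ => ⟨f.sumCongr g, .of_sum (f.sumCongr g).contMDiff
    ((OrientationPreserving.inl M' N').comp hf) ((OrientationPreserving.inr M' N').comp hg)⟩

lemma OrientedDiffeomorphic.sum_comm (M N : CompactOriented I) :
    OrientedDiffeomorphic (M.sum N) (N.sum M) :=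
  ⟨Diffeomorph.sumComm I M ∞ N, .of_sum (Diffeomorph.sumComm I M ∞ N).contMDiff
    (OrientationPreserving.inr N M) (OrientationPreserving.inl N M)⟩

lemma OrientedDiffeomorphic.sum_assoc (M N P : CompactOriented I) :
    OrientedDiffeomorphic ((M.sum N).sum P) (M.sum (N.sum P)) := by
  refine ⟨Diffeomorph.sumAssoc I M ∞ N P, .of_sum (Diffeomorph.sumAssoc I M ∞ N P).contMDiff
    (.of_sum ?_ (.inl M (N.sum P)) ((OrientationPreserving.inr M (N.sum P)).comp (.inl N P)))
    ((OrientationPreserving.inr M (N.sum P)).comp (.inr N P))⟩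
  exact (Diffeomorph.sumAssoc I M ∞ N P).contMDiff.comp (ContMDiff.inl (M := M.sum N) (M' := P))

lemma OrientedDiffeomorphic.sum_empty (M : CompactOriented I) :
    OrientedDiffeomorphic (M.sum (.empty I)) M :=
  ⟨Diffeomorph.sumEmpty I M (M' := CompactOriented.empty I) ∞,
    .of_sum (Diffeomorph.sumEmpty I M (M' := CompactOriented.empty I) ∞).contMDiff
      (OrientationPreserving.id M)
      ⟨fun x => isEmptyElim x, fun x => isEmptyElim x⟩⟩

end Manifolds
/-! ### Cobordisms -/

/-- Closed oriented smooth `d`-manifolds. -/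
abbrev ClosedManifold (d : ℕ) := CompactOriented (𝓡 d)

/-- Compact oriented smooth `(d+1)`-manifolds with boundary. -/
abbrev ManifoldWithBoundary (d : ℕ) := CompactOriented (𝓡∂ (d + 1))

section Cobordisms

variable {d : ℕ}

/-- The tangent vector `v` at the boundary point `p` points into the manifold: in the preferred
chart at `p`, with values in the half-space `{x | 0 ≤ x 0}`, its coordinate `v 0` is positive. -/
def IsInward {W : ManifoldWithBoundary d} (p : W) (v : TangentSpace (𝓡∂ (d + 1)) p) : Prop :=
  0 < (show EuclideanSpace ℝ (Fin (d + 1)) from v) 0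

/-- The tangent vector `v` at the boundary point `p` points out of the manifold. -/
def IsOutward {W : ManifoldWithBoundary d} (p : W) (v : TangentSpace (𝓡∂ (d + 1)) p) : Prop :=
  (show EuclideanSpace ℝ (Fin (d + 1)) from v) 0 < 0

/-- An oriented cobordism `S ⇝ T` between closed `d`-manifolds: a compact oriented manifold with
boundary `bulk` whose boundary is the disjoint union of the in-boundary `range inMap` and the
out-boundary `range outMap`, with diffeomorphisms `inMap` and `outMap` from `S` and `T` onto these.
The boundary carries the orientation "outward vector first"; `outMap` preserves it and `inMap`
reverses it. (The orientation conditions make the differentials of the two maps injective.) -/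
structure Cobordism (S T : ClosedManifold d) where
  bulk : ManifoldWithBoundary d
  inMap : S → bulk
  outMap : T → bulk
  contMDiff_inMap : ContMDiff (𝓡 d) (𝓡∂ (d + 1)) ∞ inMap
  contMDiff_outMap : ContMDiff (𝓡 d) (𝓡∂ (d + 1)) ∞ outMap
  injective_inMap : Function.Injective inMap
  injective_outMap : Function.Injective outMap
  inMap_ne_outMap : ∀ x y, inMap x ≠ outMap y
  boundary_eq : (𝓡∂ (d + 1)).boundary bulk = Set.range inMap ∪ Set.range outMap
  orient_inMap : ∀ (x : S) (v : TangentSpace (𝓡∂ (d + 1)) (inMap x))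
    (w : Fin d → TangentSpace (𝓡 d) x), IsInward (inMap x) v →
      orientSign (bulk.orient (inMap x))
        (Matrix.vecCons v (fun i => mfderiv (𝓡 d) (𝓡∂ (d + 1)) inMap x (w i))) =
      orientSign (S.orient x) w
  orient_outMap : ∀ (x : T) (v : TangentSpace (𝓡∂ (d + 1)) (outMap x))
    (w : Fin d → TangentSpace (𝓡 d) x), IsOutward (outMap x) v →
      orientSign (bulk.orient (outMap x))
        (Matrix.vecCons v (fun i => mfderiv (𝓡 d) (𝓡∂ (d + 1)) outMap x (w i))) =
      orientSign (T.orient x) w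

/-- Equivalence of cobordisms: an orientation preserving diffeomorphism that is compatible with the
boundary diffeomorphisms. -/
def Cobordism.Equivalent {S T : ClosedManifold d} (M N : Cobordism S T) : Prop :=
  ∃ f : Diffeomorph (𝓡∂ (d + 1)) (𝓡∂ (d + 1)) M.bulk N.bulk ∞,
    OrientationPreserving M.bulk N.bulk f ∧
    (∀ x, f (M.inMap x) = N.inMap x) ∧ (∀ x, f (M.outMap x) = N.outMap x)

/-- `C` is a mapping cylinder of `f : S → T` (for `f = id`: a cylinder `S × [0,1]`): up to a
diffeomorphism it is `S × [0,1]`, with in-boundary diffeomorphism `x ↦ (x, 0)` and out-boundary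
diffeomorphism `f x ↦ (x, 1)`. -/
def Cobordism.IsMappingCylinder {S T : ClosedManifold d} (f : S → T) (C : Cobordism S T) : Prop :=
  ∃ Φ : Diffeomorph ((𝓡 d).prod (𝓡∂ 1)) (𝓡∂ (d + 1)) (S × Set.Icc (0 : ℝ) 1) C.bulk ∞,
    (∀ x, Φ (x, 0) = C.inMap x) ∧ (∀ x, Φ (x, 1) = C.outMap (f x))

/-- `c : S × [0,∞) → W` is a collar of the part `range φ` of the boundary of `W`: a diffeomorphism
onto an open subset with `c (x, 0) = φ x`. (`EuclideanHalfSpace 1` is `[0,∞)`.) -/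
def IsCollar {S : ClosedManifold d} {W : ManifoldWithBoundary d} (φ : S → W)
    (c : S × EuclideanHalfSpace 1 → W) : Prop :=
  IsLocalDiffeomorph ((𝓡 d).prod (𝓡∂ 1)) (𝓡∂ (d + 1)) ∞ c ∧ Function.Injective c ∧
    ∀ x, c (x, 0) = φ x

/-- `W` is obtained by gluing `M` and `N` along the diffeomorphism `f` from (the manifold `T` that
parametrizes) the out-boundary of `M` to (the manifold `T'` that parametrizes) the in-boundary of
`N`. That is, `W = M ∪ N` with the out-boundary point of `M` given by `x` identified with the
in-boundary point of `N` given by `f x` and with no other identification, and the smooth structure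
of `W` is the one obtained from a choice of collars of the two boundaries: these collars fit
together to a smooth bicollar `T × ℝ → W`. For `f = id` this is the composition `M N` of cobordisms
`M : S ⇝ T` and `N : T ⇝ U`. -/
def Cobordism.IsGluing {S T T' U : ClosedManifold d} (M : Cobordism S T) (f : T → T')
    (N : Cobordism T' U) (W : Cobordism S U) : Prop :=
  ∃ (i : M.bulk → W.bulk) (j : N.bulk → W.bulk),
    OrientationPreserving M.bulk W.bulk i ∧ OrientationPreserving N.bulk W.bulk j ∧
    Function.Injective i ∧ Function.Injective j ∧
    Set.range i ∪ Set.range j = Set.univ ∧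
    (∀ p q, i p = j q ↔ ∃ x, p = M.outMap x ∧ q = N.inMap (f x)) ∧
    (∀ x, i (M.inMap x) = W.inMap x) ∧ (∀ x, j (N.outMap x) = W.outMap x) ∧
    ∃ (c : T × EuclideanHalfSpace 1 → M.bulk) (c' : T × EuclideanHalfSpace 1 → N.bulk)
      (b : T × ℝ → W.bulk),
      IsCollar M.outMap c ∧ IsCollar (fun x => N.inMap (f x)) c' ∧
      IsLocalDiffeomorph ((𝓡 d).prod 𝓘(ℝ, ℝ)) (𝓡∂ (d + 1)) ∞ b ∧
      ∀ (x : T) (t : EuclideanHalfSpace 1),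
        b (x, -(t.val 0)) = i (c (x, t)) ∧ b (x, t.val 0) = j (c' (x, t))

section

variable {A B C D : Type} [TopologicalSpace A] [TopologicalSpace B] [TopologicalSpace C]
  [TopologicalSpace D] [ChartedSpace (EuclideanSpace ℝ (Fin d)) A]
  [ChartedSpace (EuclideanSpace ℝ (Fin d)) B] [ChartedSpace (EuclideanHalfSpace (d + 1)) C]
  [ChartedSpace (EuclideanHalfSpace (d + 1)) D]

lemma mfderiv_sumMap_inl {f : A → C} {g : B → D} (hf : ContMDiff (𝓡 d) (𝓡∂ (d + 1)) ∞ f)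
    (hg : ContMDiff (𝓡 d) (𝓡∂ (d + 1)) ∞ g) (x : A) :
    mfderiv (𝓡 d) (𝓡∂ (d + 1)) (Sum.map f g) (Sum.inl x) = mfderiv (𝓡 d) (𝓡∂ (d + 1)) f x := by
  have e := mfderiv_comp (g := Sum.map f g) (f := (Sum.inl : A → A ⊕ B)) x
    ((hf.sumMap hg _).mdifferentiableAt (by simp))
    ((ContMDiff.inl (n := ∞) (I := 𝓡 d) x).mdifferentiableAt (by simp))
  have e' := mfderiv_comp (g := (Sum.inl : C → C ⊕ D)) (f := f) x
    ((ContMDiff.inl (n := ∞) (I := 𝓡∂ (d + 1)) _).mdifferentiableAt (by simp))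
    ((hf _).mdifferentiableAt (by simp))
  have e2 : mfderiv (𝓡 d) (𝓡 d) (Sum.inl : A → A ⊕ B) x = ContinuousLinearMap.id ℝ _ :=
    mfderiv_sumInl (p := (Sum.inl x : A ⊕ B))
  have e3 : mfderiv (𝓡∂ (d + 1)) (𝓡∂ (d + 1)) (Sum.inl : C → C ⊕ D) (f x) =
      ContinuousLinearMap.id ℝ _ := mfderiv_sumInl (p := (Sum.inl (f x) : C ⊕ D))
  rw [e2] at e
  rw [e3] at e'
  exact e.symm.trans e'

lemma mfderiv_sumMap_inr {f : A → C} {g : B → D} (hf : ContMDiff (𝓡 d) (𝓡∂ (d + 1)) ∞ f)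
    (hg : ContMDiff (𝓡 d) (𝓡∂ (d + 1)) ∞ g) (x : B) :
    mfderiv (𝓡 d) (𝓡∂ (d + 1)) (Sum.map f g) (Sum.inr x) = mfderiv (𝓡 d) (𝓡∂ (d + 1)) g x := by
  have e := mfderiv_comp (g := Sum.map f g) (f := (Sum.inr : B → A ⊕ B)) x
    ((hf.sumMap hg _).mdifferentiableAt (by simp))
    ((ContMDiff.inr (n := ∞) (I := 𝓡 d) x).mdifferentiableAt (by simp))
  have e' := mfderiv_comp (g := (Sum.inr : D → C ⊕ D)) (f := g) x
    ((ContMDiff.inr (n := ∞) (I := 𝓡∂ (d + 1)) _).mdifferentiableAt (by simp))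
    ((hg _).mdifferentiableAt (by simp))
  have e2 : mfderiv (𝓡 d) (𝓡 d) (Sum.inr : B → A ⊕ B) x = ContinuousLinearMap.id ℝ _ :=
    mfderiv_sumInr
  have e3 : mfderiv (𝓡∂ (d + 1)) (𝓡∂ (d + 1)) (Sum.inr : D → C ⊕ D) (g x) =
      ContinuousLinearMap.id ℝ _ := mfderiv_sumInr
  rw [e2] at e
  rw [e3] at e'
  exact e.symm.trans e'

end

/-- The disjoint union of cobordisms. -/
def Cobordism.sum {S S' T T' : ClosedManifold d} (M : Cobordism S T) (N : Cobordism S' T') :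
    Cobordism (S.sum S') (T.sum T') where
  bulk := M.bulk.sum N.bulk
  inMap := Sum.map M.inMap N.inMap
  outMap := Sum.map M.outMap N.outMap
  contMDiff_inMap := M.contMDiff_inMap.sumMap N.contMDiff_inMap
  contMDiff_outMap := M.contMDiff_outMap.sumMap N.contMDiff_outMap
  injective_inMap := Sum.map_injective.2 ⟨M.injective_inMap, N.injective_inMap⟩
  injective_outMap := Sum.map_injective.2 ⟨M.injective_outMap, N.injective_outMap⟩
  inMap_ne_outMap := by
    rintro (x | x) (y | y) h
    · exact M.inMap_ne_outMap x y (Sum.inl_injective h)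
    · exact Sum.inl_ne_inr h
    · exact Sum.inr_ne_inl h
    · exact N.inMap_ne_outMap x y (Sum.inr_injective h)
  boundary_eq := by
    have h := ModelWithCorners.boundary_disjointUnion (I := 𝓡∂ (d + 1)) (M := M.bulk)
      (M' := N.bulk)
    refine h.trans ?_
    rw [M.boundary_eq, N.boundary_eq]
    ext p
    change p ∈ Sum.inl '' (_ ∪ _) ∪ Sum.inr '' (_ ∪ _) ↔
      (∃ x, Sum.map M.inMap N.inMap x = p) ∨ (∃ x, Sum.map M.outMap N.outMap x = p)
    rcases p with p | p <;> simp
  orient_inMap := by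
    rintro (x | x) v w hv
    · erw [mfderiv_sumMap_inl M.contMDiff_inMap N.contMDiff_inMap x]
      exact M.orient_inMap x v w hv
    · erw [mfderiv_sumMap_inr M.contMDiff_inMap N.contMDiff_inMap x]
      exact N.orient_inMap x v w hv
  orient_outMap := by
    rintro (x | x) v w hv
    · erw [mfderiv_sumMap_inl M.contMDiff_outMap N.contMDiff_outMap x]
      exact M.orient_outMap x v w hv
    · erw [mfderiv_sumMap_inr M.contMDiff_outMap N.contMDiff_outMap x]
      exact N.orient_outMap x v w hv

end Cobordisms

/-! ### The group `SKK_n`, where `n = d + 1` -/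

section SKK

variable (d : ℕ)

/-- Closed oriented `(d+1)`-manifolds, as compact manifolds with empty boundary. -/
def ClosedBulk := {X : ManifoldWithBoundary d // (𝓡∂ (d + 1)).boundary X = ∅}

variable {d}

/-- A closed `(d+1)`-manifold as a cobordism from the empty manifold to itself. -/
def ClosedBulk.toCobordism (X : ClosedBulk d) :
    Cobordism (CompactOriented.empty (𝓡 d)) (CompactOriented.empty (𝓡 d)) where
  bulk := X.1
  inMap := isEmptyElim
  outMap := isEmptyElim
  contMDiff_inMap x := isEmptyElim x
  contMDiff_outMap x := isEmptyElim x
  injective_inMap x := isEmptyElim x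
  injective_outMap x := isEmptyElim x
  inMap_ne_outMap x := isEmptyElim x
  boundary_eq := by rw [X.2, Set.range_eq_empty, Set.union_empty]
  orient_inMap x := isEmptyElim x
  orient_outMap x := isEmptyElim x

/-- The disjoint union of closed manifolds. -/
def ClosedBulk.sum (X Y : ClosedBulk d) : ClosedBulk d :=
  ⟨X.1.sum Y.1, by
    refine (ModelWithCorners.boundary_disjointUnion (I := 𝓡∂ (d + 1)) (M := X.1)
      (M' := Y.1)).trans ?_
    rw [X.2, Y.2, Set.image_empty, Set.image_empty, Set.union_empty]
    rfl⟩

/-- The empty closed manifold. -/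
def ClosedBulk.empty : ClosedBulk d :=
  ⟨.empty (𝓡∂ (d + 1)), Set.eq_empty_of_isEmpty _⟩

variable (d)

instance ClosedBulk.setoid : Setoid (ClosedBulk d) where
  r X Y := OrientedDiffeomorphic X.1 Y.1
  iseqv := ⟨fun X => .refl X.1, .symm, .trans⟩

/-- The set `𝕄_n`, `n = d + 1`, of closed oriented `n`-manifolds up to orientation preserving
diffeomorphism. -/
def ManifoldClass := Quotient (ClosedBulk.setoid d)

instance : Zero (ManifoldClass d) := ⟨Quotient.mk _ .empty⟩

instance : Add (ManifoldClass d) :=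
  ⟨Quotient.map₂ ClosedBulk.sum fun _ _ h _ _ h' => OrientedDiffeomorphic.sum_congr h h'⟩

/-- `𝕄_n` is a commutative monoid under disjoint union. -/
instance : AddCommMonoid (ManifoldClass d) where
  add_assoc := by
    rintro ⟨X⟩ ⟨Y⟩ ⟨Z⟩
    exact Quotient.sound (OrientedDiffeomorphic.sum_assoc X.1 Y.1 Z.1)
  add_comm := by
    rintro ⟨X⟩ ⟨Y⟩
    exact Quotient.sound (OrientedDiffeomorphic.sum_comm X.1 Y.1)
  add_zero := by
    rintro ⟨X⟩
    exact Quotient.sound (OrientedDiffeomorphic.sum_empty X.1)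
  zero_add := by
    rintro ⟨X⟩
    exact Quotient.sound ((OrientedDiffeomorphic.sum_comm _ X.1).trans
      (OrientedDiffeomorphic.sum_empty X.1))
  nsmul := nsmulRec

variable {d}

/-- The class of `X` in the Grothendieck group of `𝕄_n`. -/
def ClosedBulk.toGrothendieck (X : ClosedBulk d) : Algebra.GrothendieckAddGroup (ManifoldClass d) :=
  Algebra.GrothendieckAddGroup.of (Quotient.mk (ClosedBulk.setoid d) X : ManifoldClass d)

/-- `X = X₁ ∪_f X₂` for a diffeomorphism `f : S → S` of the common boundary of `X₁` and `X₂`. -/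
def IsClosedGluing {S : ClosedManifold d} (X₁ : Cobordism (.empty (𝓡 d)) S) (f : S → S)
    (X₂ : Cobordism S (.empty (𝓡 d))) (X : ClosedBulk d) : Prop :=
  Cobordism.IsGluing X₁ f X₂ X.toCobordism

variable (d)

/-- The subgroup `R_n^SKK` generated by the elements `[M] - [N] - [M'] + [N']` for which
`M = X₁ ∪_f X₂`, `N = X₁ ∪_g X₂`, `M' = Y₁ ∪_f Y₂`, `N' = Y₁ ∪_g Y₂` with the same orientation
preserving gluing diffeomorphisms `f, g : S → S`. -/
def relationsSKK : AddSubgroup (Algebra.GrothendieckAddGroup (ManifoldClass d)) :=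
  AddSubgroup.closure {z | ∃ (S : ClosedManifold d) (X₁ Y₁ : Cobordism (.empty (𝓡 d)) S)
    (X₂ Y₂ : Cobordism S (.empty (𝓡 d))) (f g : Diffeomorph (𝓡 d) (𝓡 d) S S ∞)
    (M N M' N' : ClosedBulk d),
    OrientationPreserving S S f ∧ OrientationPreserving S S g ∧
    IsClosedGluing X₁ f X₂ M ∧ IsClosedGluing X₁ g X₂ N ∧
    IsClosedGluing Y₁ f Y₂ M' ∧ IsClosedGluing Y₁ g Y₂ N' ∧
    z = M.toGrothendieck - N.toGrothendieck - M'.toGrothendieck + N'.toGrothendieck}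

/-- The group `SKK_n`, `n = d + 1`. -/
abbrev SKK := Algebra.GrothendieckAddGroup (ManifoldClass d) ⧸ relationsSKK d

variable {d}

/-- The class `[X]_SKK`. -/
def ClosedBulk.toSKK (X : ClosedBulk d) : SKK d := QuotientAddGroup.mk X.toGrothendieck

end SKK

/-! ### Topological quantum field theories -/

section TQFT

/-- An `n`-dimensional oriented TQFT over `k`, `n = d + 1`: a symmetric monoidal functor from
`n`-cobordisms to vector spaces. -/
structure TQFT (k : Type u) [Field k] (d : ℕ) where
  obj : ClosedManifold d → Type u
  [addCommGroup : ∀ S, AddCommGroup (obj S)]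
  [module : ∀ S, Module k (obj S)]
  map : ∀ {S T : ClosedManifold d}, Cobordism S T → (obj S →ₗ[k] obj T)
  map_equivalent : ∀ {S T : ClosedManifold d} (M N : Cobordism S T),
    M.Equivalent N → map M = map N
  map_gluing : ∀ {S T U : ClosedManifold d} (M : Cobordism S T) (N : Cobordism T U)
    (W : Cobordism S U), M.IsGluing (fun x => x) N W → map W = map N ∘ₗ map M
  map_cylinder : ∀ {S : ClosedManifold d} (C : Cobordism S S),
    C.IsMappingCylinder (fun x => x) → map C = LinearMap.id
  /-- the isomorphism of the value of the empty manifold with `k` -/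
  unit : k ≃ₗ[k] obj (.empty (𝓡 d))
  /-- the isomorphisms of the value of a disjoint union with the tensor product -/
  tensor : ∀ S T : ClosedManifold d, obj S ⊗[k] obj T ≃ₗ[k] obj (S.sum T)
  map_sum : ∀ {S S' T T' : ClosedManifold d} (M : Cobordism S T) (N : Cobordism S' T')
    (a : obj S) (b : obj S'),
    map (M.sum N) (tensor S S' (a ⊗ₜ b)) = tensor T T' (map M a ⊗ₜ map N b)
  /-- compatibility with `(S ⊔ T) ⊔ U = S ⊔ (T ⊔ U)`; `C` is the cobordism of this identification -/
  tensor_assoc : ∀ {S T U : ClosedManifold d}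
    (C : Cobordism ((S.sum T).sum U) (S.sum (T.sum U))),
    C.IsMappingCylinder (Equiv.sumAssoc S T U) → ∀ (a : obj S) (b : obj T) (c : obj U),
    map C (tensor _ _ (tensor _ _ (a ⊗ₜ b) ⊗ₜ c)) = tensor _ _ (a ⊗ₜ tensor _ _ (b ⊗ₜ c))
  /-- compatibility with `∅ ⊔ S = S` -/
  unit_tensor : ∀ {S : ClosedManifold d} (C : Cobordism ((CompactOriented.empty (𝓡 d)).sum S) S),
    C.IsMappingCylinder (Equiv.emptySum (CompactOriented.empty (𝓡 d)) S) → ∀ a : obj S,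
    map C (tensor _ _ (unit 1 ⊗ₜ a)) = a
  /-- compatibility with `S ⊔ ∅ = S` -/
  tensor_unit : ∀ {S : ClosedManifold d} (C : Cobordism (S.sum (.empty (𝓡 d))) S),
    C.IsMappingCylinder (Equiv.sumEmpty S (CompactOriented.empty (𝓡 d))) → ∀ a : obj S,
    map C (tensor _ _ (a ⊗ₜ unit 1)) = a
  /-- compatibility with `S ⊔ T = T ⊔ S` -/
  tensor_comm : ∀ {S T : ClosedManifold d} (C : Cobordism (S.sum T) (T.sum S)),
    C.IsMappingCylinder (Equiv.sumComm S T) → ∀ (a : obj S) (b : obj T),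
    map C (tensor _ _ (a ⊗ₜ b)) = tensor _ _ (b ⊗ₜ a)

attribute [instance] TQFT.addCommGroup TQFT.module

variable {k : Type u} [Field k] {d : ℕ}

/-- Isomorphisms of TQFTs: monoidal natural isomorphisms. -/
structure TQFT.Iso (F G : TQFT k d) where
  app : ∀ S : ClosedManifold d, F.obj S ≃ₗ[k] G.obj S
  naturality : ∀ {S T : ClosedManifold d} (M : Cobordism S T) (a : F.obj S),
    app T (F.map M a) = G.map M (app S a)
  app_unit : app _ (F.unit 1) = G.unit 1
  app_tensor : ∀ {S T : ClosedManifold d} (a : F.obj S) (b : F.obj T),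
    app _ (F.tensor S T (a ⊗ₜ b)) = G.tensor S T (app S a ⊗ₜ app T b)

/-- The inverse isomorphism. -/
def TQFT.Iso.symm {F G : TQFT k d} (e : F.Iso G) : G.Iso F where
  app S := (e.app S).symm
  naturality M a := by
    rw [LinearEquiv.symm_apply_eq, e.naturality, LinearEquiv.apply_symm_apply]
  app_unit := by rw [LinearEquiv.symm_apply_eq, e.app_unit]
  app_tensor a b := by
    rw [LinearEquiv.symm_apply_eq, e.app_tensor, LinearEquiv.apply_symm_apply,
      LinearEquiv.apply_symm_apply]

/-- Composition of isomorphisms. -/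
def TQFT.Iso.trans {F G K : TQFT k d} (e : F.Iso G) (e' : G.Iso K) : F.Iso K where
  app S := (e.app S).trans (e'.app S)
  naturality M a := by simp [e.naturality, e'.naturality]
  app_unit := by simp [e.app_unit, e'.app_unit]
  app_tensor a b := by simp [e.app_tensor, e'.app_tensor]

instance TQFT.setoid : Setoid (TQFT k d) where
  r F G := Nonempty (F.Iso G)
  iseqv :=
    { refl := fun _ => ⟨⟨fun _ => .refl k _, fun _ _ => rfl, rfl, fun _ _ => rfl⟩⟩
      symm := fun ⟨e⟩ => ⟨e.symm⟩
      trans := fun ⟨e⟩ ⟨e'⟩ => ⟨e.trans e'⟩ }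

/-- The trivial TQFT. -/
def TQFT.trivial (k : Type u) [Field k] (d : ℕ) : TQFT k d where
  obj _ := k
  map _ := LinearMap.id
  map_equivalent _ _ _ := rfl
  map_gluing _ _ _ _ := rfl
  map_cylinder _ _ := rfl
  unit := .refl k k
  tensor _ _ := TensorProduct.lid k k
  map_sum _ _ _ _ := rfl
  tensor_assoc _ _ _ _ _ := by simp [mul_assoc]
  unit_tensor _ _ _ := by simp
  tensor_unit _ _ _ := by simp
  tensor_comm _ _ _ _ := by simp [mul_comm]

/-- The product of two TQFTs. -/
def TQFT.mul (F G : TQFT k d) : TQFT k d where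
  obj S := F.obj S ⊗[k] G.obj S
  map M := TensorProduct.map (F.map M) (G.map M)
  map_equivalent M N h := by rw [F.map_equivalent M N h, G.map_equivalent M N h]
  map_gluing M N W h := by
    rw [F.map_gluing M N W h, G.map_gluing M N W h, TensorProduct.map_comp]
  map_cylinder C h := by rw [F.map_cylinder C h, G.map_cylinder C h, TensorProduct.map_id]
  unit := (TensorProduct.lid k k).symm.trans (TensorProduct.congr F.unit G.unit)
  tensor S T := (TensorProduct.tensorTensorTensorComm k (F.obj S) (G.obj S) (F.obj T)
    (G.obj T)).trans (TensorProduct.congr (F.tensor S T) (G.tensor S T))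
  map_sum M N a b := by
    induction a with
    | zero => simp
    | add a a' h h' => simp only [TensorProduct.add_tmul, map_add, h, h']
    | tmul a a' =>
      induction b with
      | zero => simp
      | add b b' h h' => simp only [TensorProduct.tmul_add, map_add, h, h']
      | tmul b b' => simp [F.map_sum, G.map_sum]
  tensor_assoc C h a b c := by
    induction a with
    | zero => simp
    | add a a' h h' => simp only [TensorProduct.add_tmul, map_add, h, h']
    | tmul a a' =>
      induction b with
      | zero => simp
      | add b b' h h' => simp only [TensorProduct.add_tmul, TensorProduct.tmul_add, map_add, h, h']
      | tmul b b' =>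
        induction c with
        | zero => simp
        | add c c' h h' => simp only [TensorProduct.tmul_add, map_add, h, h']
        | tmul c c' => simp [F.tensor_assoc C h, G.tensor_assoc C h]
  unit_tensor C h a := by
    induction a with
    | zero => simp
    | add a a' h h' => simp only [TensorProduct.tmul_add, map_add, h, h']
    | tmul a a' => simp [F.unit_tensor C h, G.unit_tensor C h]
  tensor_unit C h a := by
    induction a with
    | zero => simp
    | add a a' h h' => simp only [TensorProduct.add_tmul, map_add, h, h']
    | tmul a a' => simp [F.tensor_unit C h, G.tensor_unit C h]
  tensor_comm C h a b := by
    induction a with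
    | zero => simp
    | add a a' h h' => simp only [TensorProduct.add_tmul, TensorProduct.tmul_add, map_add, h, h']
    | tmul a a' =>
      induction b with
      | zero => simp
      | add b b' h h' => simp only [TensorProduct.add_tmul, TensorProduct.tmul_add, map_add, h, h']
      | tmul b b' => simp [F.tensor_comm C h, G.tensor_comm C h]

variable (k d) in
/-- The TQFTs up to isomorphism. -/
def TQFTClass := Quotient (TQFT.setoid (k := k) (d := d))

/-- The isomorphism class of a TQFT. -/
def TQFT.toClass (F : TQFT k d) : TQFTClass k d := Quotient.mk _ F

/-- An isomorphism from a product of TQFTs is determined by its values on pure tensors. -/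
def TQFT.Iso.ofMul {F G K : TQFT k d} (e : ∀ S, F.obj S ⊗[k] G.obj S ≃ₗ[k] K.obj S)
    (h₁ : ∀ {S T : ClosedManifold d} (M : Cobordism S T) (a : F.obj S) (b : G.obj S),
      e T (F.map M a ⊗ₜ G.map M b) = K.map M (e S (a ⊗ₜ b)))
    (h₂ : e _ (F.unit 1 ⊗ₜ G.unit 1) = K.unit 1)
    (h₃ : ∀ {S T : ClosedManifold d} (a : F.obj S) (b : G.obj S) (a' : F.obj T) (b' : G.obj T),
      e _ (F.tensor S T (a ⊗ₜ a') ⊗ₜ G.tensor S T (b ⊗ₜ b')) =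
        K.tensor S T (e S (a ⊗ₜ b) ⊗ₜ e T (a' ⊗ₜ b'))) : (F.mul G).Iso K where
  app := e
  naturality {S T} M a := LinearMap.congr_fun (TensorProduct.ext'
    (g := (e T).toLinearMap ∘ₗ TensorProduct.map (F.map M) (G.map M))
    (h := K.map M ∘ₗ (e S).toLinearMap) fun a b => h₁ M a b) a
  app_unit := by
    change e _ (TensorProduct.congr F.unit G.unit ((TensorProduct.lid k k).symm 1)) = _
    simpa using h₂
  app_tensor {S T} a b := LinearMap.congr_fun (TensorProduct.ext_fourfold'
    (φ := (e _).toLinearMap ∘ₗ ((F.mul G).tensor S T).toLinearMap)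
    (ψ := (K.tensor S T).toLinearMap ∘ₗ
      TensorProduct.map (e S).toLinearMap (e T).toLinearMap) fun a b a' b' => h₃ a b a' b') (a ⊗ₜ b)

/-- The product of TQFTs respects isomorphisms. -/
def TQFT.Iso.mul {F F' G G' : TQFT k d} (e : F.Iso F') (e' : G.Iso G') :
    (F.mul G).Iso (F'.mul G') :=
  .ofMul (fun S => TensorProduct.congr (e.app S) (e'.app S))
    (fun M a b => by
      change e.app _ (F.map M a) ⊗ₜ e'.app _ (G.map M b) =
        F'.map M (e.app _ a) ⊗ₜ G'.map M (e'.app _ b)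
      rw [e.naturality, e'.naturality])
    (by
      change e.app _ (F.unit 1) ⊗ₜ e'.app _ (G.unit 1) = F'.unit 1 ⊗ₜ G'.unit 1
      rw [e.app_unit, e'.app_unit])
    (fun a b a' b' => by
      change e.app _ (F.tensor _ _ (a ⊗ₜ a')) ⊗ₜ e'.app _ (G.tensor _ _ (b ⊗ₜ b')) =
        F'.tensor _ _ (e.app _ a ⊗ₜ e.app _ a') ⊗ₜ G'.tensor _ _ (e'.app _ b ⊗ₜ e'.app _ b')
      rw [e.app_tensor, e'.app_tensor])

/-- Commutativity of the product of TQFTs. -/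
def TQFT.Iso.comm (F G : TQFT k d) : (F.mul G).Iso (G.mul F) :=
  .ofMul (fun S => TensorProduct.comm k (F.obj S) (G.obj S)) (fun _ _ _ => rfl)
    rfl (fun _ _ _ _ => rfl)

/-- The trivial TQFT is an identity element. -/
def TQFT.Iso.one (F : TQFT k d) : ((TQFT.trivial k d).mul F).Iso F :=
  .ofMul (fun S => TensorProduct.lid k (F.obj S)) (fun M (a : k) b => by
      change a • F.map M b = F.map M (a • b)
      rw [map_smul])
    (by
      change (1 : k) • F.unit 1 = F.unit 1
      rw [one_smul])
    (fun {S T} (a : k) b (a' : k) b' => by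
      change (a • a') • F.tensor S T (b ⊗ₜ b') = F.tensor S T ((a • b) ⊗ₜ (a' • b'))
      rw [TensorProduct.smul_tmul_smul, map_smul, smul_eq_mul])

/-- Associativity of the product of TQFTs. -/
def TQFT.Iso.assoc (F G K : TQFT k d) : ((F.mul G).mul K).Iso (F.mul (G.mul K)) :=
  .ofMul (fun S => TensorProduct.assoc k (F.obj S) (G.obj S) (K.obj S))
    (fun {S T} M a b => LinearMap.congr_fun (TensorProduct.ext_threefold
      (g := (TensorProduct.assoc k (F.obj T) (G.obj T) (K.obj T)).toLinearMap ∘ₗ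
        TensorProduct.map (TensorProduct.map (F.map M) (G.map M)) (K.map M))
      (h := TensorProduct.map (F.map M) (TensorProduct.map (G.map M) (K.map M)) ∘ₗ
        (TensorProduct.assoc k (F.obj S) (G.obj S) (K.obj S)).toLinearMap)
      fun _ _ _ => rfl) (a ⊗ₜ b))
    rfl
    (fun {S T} a b a' b' => LinearMap.congr_fun (TensorProduct.ext_fourfold'
      (φ := (TensorProduct.assoc k _ _ _).toLinearMap ∘ₗ
        (TensorProduct.mk k _ _).flip (K.tensor S T (b ⊗ₜ b')) ∘ₗ
          ((F.mul G).tensor S T).toLinearMap)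
      (ψ := ((F.mul (G.mul K)).tensor S T).toLinearMap ∘ₗ TensorProduct.map
        ((TensorProduct.assoc k _ _ _).toLinearMap ∘ₗ (TensorProduct.mk k _ _).flip b)
        ((TensorProduct.assoc k _ _ _).toLinearMap ∘ₗ (TensorProduct.mk k _ _).flip b'))
      fun _ _ _ _ => rfl) (a ⊗ₜ a'))

/-- The isomorphism classes of TQFTs form a commutative monoid under the product of TQFTs, with
the class of the trivial TQFT as the identity element. -/
instance : CommMonoid (TQFTClass k d) where
  mul := Quotient.map₂ TQFT.mul fun _ _ ⟨e⟩ _ _ ⟨e'⟩ => ⟨e.mul e'⟩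
  one := (TQFT.trivial k d).toClass
  mul_assoc := by
    rintro ⟨F⟩ ⟨G⟩ ⟨K⟩
    exact Quotient.sound ⟨.assoc F G K⟩
  mul_comm := by
    rintro ⟨F⟩ ⟨G⟩
    exact Quotient.sound ⟨.comm F G⟩
  one_mul := by
    rintro ⟨F⟩
    exact Quotient.sound ⟨.one F⟩
  mul_one := by
    rintro ⟨F⟩
    exact Quotient.sound ⟨(TQFT.Iso.comm F (.trivial k d)).trans (.one F)⟩

variable (k d) in
/-- The group `nTQFT_k^×`, `n = d + 1`, of (isomorphism classes of) invertible TQFTs, that is, of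
TQFTs `F` for which there is a TQFT `G` such that the product of `F` and `G` is isomorphic to the
trivial TQFT. -/
abbrev InvertibleTQFTGroup := (TQFTClass k d)ˣ

/-- The scalar `δ (F X)` by which `F` acts on the value of the empty manifold, for a closed
`n`-manifold `X` regarded as a cobordism from the empty manifold to itself; the value of the empty
manifold is identified with `k`, and `Hom_k (k, k)` with `k` through `δ φ = φ 1`. -/
def TQFT.closedValue (F : TQFT k d) (X : ClosedBulk d) : k :=
  F.unit.symm (F.map X.toCobordism (F.unit 1))

/-- `F M = id` for each cobordism `M` with empty boundary. -/
def TQFT.IsTrivialOnClosed (F : TQFT k d) : Prop :=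
  ∀ M : Cobordism (CompactOriented.empty (𝓡 d)) (CompactOriented.empty (𝓡 d)),
    F.map M = LinearMap.id

lemma TQFT.IsTrivialOnClosed.of_iso {F G : TQFT k d} (e : F.Iso G) (h : F.IsTrivialOnClosed) :
    G.IsTrivialOnClosed := fun M => by
  ext a
  obtain ⟨b, rfl⟩ := (e.app _).surjective a
  rw [← e.naturality, h M]
  rfl

lemma TQFT.IsTrivialOnClosed.mul {F G : TQFT k d} (hF : F.IsTrivialOnClosed)
    (hG : G.IsTrivialOnClosed) : (F.mul G).IsTrivialOnClosed := fun M => by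
  change TensorProduct.map (F.map M) (G.map M) = LinearMap.id
  rw [hF M, hG M, TensorProduct.map_id]

lemma TQFT.IsTrivialOnClosed.of_mul {F G : TQFT k d} (hF : F.IsTrivialOnClosed)
    (h : (F.mul G).IsTrivialOnClosed) : G.IsTrivialOnClosed := fun M => by
  have e : TensorProduct.map (F.map M) (G.map M) = LinearMap.id := h M
  rw [hF M] at e
  ext b
  have e' := LinearMap.congr_fun e (F.unit 1 ⊗ₜ b)
  have e'' := congrArg (fun z => TensorProduct.lid k _
    (TensorProduct.map F.unit.symm.toLinearMap LinearMap.id z)) e'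
  simpa using e''

variable (k d) in
/-- The subgroup of the invertible TQFTs `F` with `F M = id` for each cobordism `M` with empty
boundary. -/
def trivialOnClosed : Subgroup (InvertibleTQFTGroup k d) where
  carrier := {u | ∀ F : TQFT k d, F.toClass = u → F.IsTrivialOnClosed}
  one_mem' F h := by
    obtain ⟨e⟩ := Quotient.exact h
    exact .of_iso e.symm fun _ => rfl
  mul_mem' {u v} hu hv F h := by
    obtain ⟨F₁, h₁⟩ := Quotient.exists_rep (u : TQFTClass k d)
    obtain ⟨F₂, h₂⟩ := Quotient.exists_rep (v : TQFTClass k d)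
    have h' : F.toClass = (F₁.mul F₂).toClass := by
      rw [h, Units.val_mul, ← h₁, ← h₂]; rfl
    obtain ⟨e⟩ := Quotient.exact h'
    exact .of_iso e.symm ((hu F₁ h₁).mul (hv F₂ h₂))
  inv_mem' {u} hu F h := by
    obtain ⟨F₁, h₁⟩ := Quotient.exists_rep (u : TQFTClass k d)
    have h' : (TQFT.trivial k d).toClass = (F₁.mul F).toClass := by
      change 1 = F₁.toClass * F.toClass
      rw [h, show F₁.toClass = (u : TQFTClass k d) from h₁, Units.mul_inv]
    obtain ⟨e⟩ := Quotient.exact h'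
    exact .of_mul (hu F₁ h₁) (.of_iso e fun _ => rfl)

/-- The defining property of the homomorphism `Ψ_n : nTQFT_k^× → Hom (SKK_n, k^×)`, `n = d + 1`:
`Ψ_n (F) ([X]) = δ (F X)` for all invertible TQFTs `F` and closed `n`-manifolds `X`. -/
def IsPsi (Ψ : InvertibleTQFTGroup k d →* (Multiplicative (SKK d) →* kˣ)) : Prop :=
  ∀ (u : InvertibleTQFTGroup k d) (F : TQFT k d), F.toClass = u → ∀ X : ClosedBulk d,
    (Ψ u (Multiplicative.ofAdd X.toSKK) : k) = F.closedValue X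

end TQFT

end
end InvertibleTQFT

namespace InvertibleTQFT

noncomputable section

/-! ### Signs of families of vectors -/

section OrientSign

variable {V W : Type*} [AddCommGroup V] [Module ℝ V] [AddCommGroup W] [Module ℝ W] {n : ℕ}

/-! A TQFT `F` sends a closed manifold to an endomorphism of the value of the empty manifold, which
is a line, hence to a scalar. These scalars depend only on the diffeomorphism class of the manifold
and the isomorphism class of `F`. They are multiplicative under disjoint union
(`TQFT.closedValue_sum`) and under the product of TQFTs (`TQFT.closedValue_mul`). For an invertible
class they are units, because a monoid homomorphism carries units to units. An invertible TQFT thus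
defines a homomorphism from the Grothendieck group of `𝕄_n` to `kˣ`.

This homomorphism kills the SKK relations for the following reason. A gluing `X₁ ∪_f X₂` is the
composite of `X₁`, the mapping cylinder of `f` and `X₂`. If `F ⊗ G` is trivial, then `F.obj S` is a
line, so the mapping cylinder acts on it by a scalar `r(f)` that depends on `S` and `f` only, and
the value of the gluing is `r(f)` times a number `⟨X₁, X₂⟩` that does not involve `f`
(`TQFT.closedValue_of_isClosedGluing`). Hence `F(M) F(N')` and `F(N) F(M')` are both `r(f) r(g) ⟨X₁,
X₂⟩ ⟨Y₁, Y₂⟩`. Uniqueness holds because the classes `[X]` generate `SKK_n`. The kernel consists of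
the `F` whose scalars are all `1`, and this is triviality on closed manifolds because endomorphisms
of a line are scalars.

The geometric content is the splitting off of the mapping cylinder. It rests on `cylinder_isGluing`:
a cobordism `N` with a collar of its in-boundary is the gluing of a cylinder and `N` itself. The
cylinder embeds as the collar segment `[0,1]`, and `N` embeds in itself by a push along the collar
that moves `t` to `1 + t` near the boundary and moves nothing far away. The collar is the one
contained in the definition of a gluing. Both embeddings preserve the orientation because the set of
points at which an immersion in equal dimensions does so is clopen
(`isClopen_preservesOrientationAt`), so that one point on each collar line decides. -/

lemma alternating_apply_eq (b : Module.Basis (Fin n) ℝ V) (α : V [⋀^Fin n]→ₗ[ℝ] ℝ)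
    (v : Fin n → V) : α v = α b * b.det v := by
  conv_lhs => rw [α.eq_smul_basis_det b]
  rfl

lemma orientSign_eq (b : Module.Basis (Fin n) ℝ V) (o : Orientation ℝ V (Fin n))
    (v : Fin n → V) : orientSign o v = orientSign o b * SignType.sign (b.det v) := by
  unfold orientSign
  rw [alternating_apply_eq b, sign_mul]

lemma orientSign_basis_ne_zero (b : Module.Basis (Fin n) ℝ V) (o : Orientation ℝ V (Fin n)) :
    orientSign o b ≠ 0 := by
  unfold orientSign
  rw [Ne, sign_eq_zero_iff]
  intro h
  refine o.someVector_ne_zero ?_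
  ext v
  rw [alternating_apply_eq b, h, zero_mul]
  rfl

lemma orientSign_ne_zero_of_linearIndependent (b : Module.Basis (Fin n) ℝ V)
    (o : Orientation ℝ V (Fin n)) {v : Fin n → V} (hv : LinearIndependent ℝ v) :
    orientSign o v ≠ 0 := by
  have : Module.Finite ℝ V := .of_basis b
  have hc : Fintype.card (Fin n) = Module.finrank ℝ V := (Module.finrank_eq_card_basis b).symm
  rcases isEmpty_or_nonempty (Fin n) with h | h
  · rw [Subsingleton.elim v b]
    exact orientSign_basis_ne_zero b o
  · have := orientSign_basis_ne_zero (basisOfLinearIndependentOfCardEqFinrank hv hc) o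
    rwa [coe_basisOfLinearIndependentOfCardEqFinrank] at this

/-- Each side is a constant times the sign of the determinant with respect to `b`; a single frame of
non-zero sign compares the constants. Preservation of orientation can thus be tested on one frame.
-/
lemma orientSign_map_eq_of_eq (b : Module.Basis (Fin n) ℝ V) (L : V →ₗ[ℝ] W)
    (o : Orientation ℝ V (Fin n)) (o' : Orientation ℝ W (Fin n)) {v₀ : Fin n → V}
    (h₀ : orientSign o v₀ ≠ 0)
    (h : orientSign o' (fun i => L (v₀ i)) = orientSign o v₀) (v : Fin n → V) :
    orientSign o' (fun i => L (v i)) = orientSign o v := by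
  have key : ∀ w : Fin n → V, orientSign o' (fun i => L (w i)) =
      orientSign o' (fun i => L (b i)) * SignType.sign (b.det w) := fun w => by
    have := alternating_apply_eq b (o'.someVector.compLinearMap L) w
    unfold orientSign
    rw [← sign_mul]
    exact congrArg _ this
  rw [orientSign_eq b o] at h h₀ ⊢
  rw [key] at h ⊢
  rw [mul_right_cancel₀ (right_ne_zero_of_mul h₀) h]

lemma orientSign_rayOfNeZero (α : V [⋀^Fin n]→ₗ[ℝ] ℝ) (h : α ≠ 0) (v : Fin n → V) :
    orientSign (rayOfNeZero ℝ α h) v = SignType.sign (α v) := by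
  have h1 : SameRay ℝ (Module.Ray.someVector (rayOfNeZero ℝ α h)) α := by
    rw [← ray_eq_iff (Module.Ray.someVector_ne_zero _) h, Module.Ray.someVector_ray]
  obtain ⟨r, hr, e⟩ := h1.exists_pos_right (Module.Ray.someVector_ne_zero _) h
  unfold orientSign
  rw [e, AlternatingMap.smul_apply, smul_eq_mul, sign_mul, sign_pos hr, one_mul]

/-- The orientation for which a given basis has a given (non-zero) sign. -/
def orientationOfSign (b : Module.Basis (Fin n) ℝ V) (s : SignType) : Orientation ℝ V (Fin n) :=
  if s = 1 then rayOfNeZero ℝ b.det b.det_ne_zero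
  else rayOfNeZero ℝ (-b.det) (neg_ne_zero.2 b.det_ne_zero)

lemma orientSign_orientationOfSign (b : Module.Basis (Fin n) ℝ V) {s : SignType} (hs : s ≠ 0)
    (v : Fin n → V) : orientSign (orientationOfSign b s) v = s * SignType.sign (b.det v) := by
  unfold orientationOfSign
  split_ifs with h
  · rw [orientSign_rayOfNeZero, h, one_mul]
  · have : s = -1 := by revert hs h; cases s <;> decide
    rw [orientSign_rayOfNeZero, this, AlternatingMap.neg_apply, Left.sign_neg]
    simp

/-- `A` is the differential `D` at a point `y`, read in coordinates fixed at `x`. The coordinate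
changes `TP` and `TQ` preserve signs, so a condition in varying tangent spaces becomes a condition
on the sign of one real number. -/
lemma preserves_iff_of_conj (b : Module.Basis (Fin n) ℝ V) {oPx oPy : Orientation ℝ V (Fin n)}
    {oQx oQy : Orientation ℝ W (Fin n)} {TP TP' : V →ₗ[ℝ] V} {TQ : W →ₗ[ℝ] W} {D A : V →ₗ[ℝ] W}
    (hA : ∀ v, A v = TQ (D (TP' v))) (h : ∀ v, TP (TP' v) = v) (h' : ∀ v, TP' (TP v) = v)
    (h1 : ∀ v : Fin n → V, orientSign oPx (fun i => TP (v i)) = orientSign oPy v)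
    (h2 : ∀ v : Fin n → W, orientSign oQx (fun i => TQ (v i)) = orientSign oQy v) :
    (∀ v : Fin n → V, orientSign oQy (fun i => D (v i)) = orientSign oPy v) ↔
      orientSign oQx (fun i => A (b i)) = orientSign oPx b := by
  constructor
  · intro h3
    have h4 := h3 (fun i => TP' (b i))
    rw [← h2, ← h1] at h4
    simp only [h] at h4
    simpa only [hA] using h4
  · intro h3 v
    have h4 := orientSign_map_eq_of_eq b A oPx oQx (orientSign_basis_ne_zero b oPx) h3
      (fun i => TP (v i))
    simp only [hA, h'] at h4
    rw [← h2, ← h1, h4]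

end OrientSign

/-! ### The set of points at which a map preserves the orientation -/

/-- The standard basis of the Euclidean space. -/
abbrev stdBasis (n : ℕ) : Module.Basis (Fin n) ℝ (EuclideanSpace ℝ (Fin n)) :=
  (EuclideanSpace.basisFun (Fin n) ℝ).toBasis

section PreservesAt

variable {n : ℕ} {H : Type} [TopologicalSpace H]
  {I : ModelWithCorners ℝ (EuclideanSpace ℝ (Fin n)) H}

/-- The differential of `g` at `x` preserves the orientation. -/
def PreservesOrientationAt (P Q : CompactOriented I) (g : P → Q) (x : P) : Prop :=
  ∀ v : Fin n → TangentSpace I x,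
    orientSign (Q.orient (g x)) (fun i => mfderiv I I g x (v i)) = orientSign (P.orient x) v

/-- In coordinates fixed at `x` and `g x`, the orientation form of the target on the image of the
standard basis is a constant times the determinant of the differential. It is continuous at `x`, and
non-zero there by injectivity, so its sign is locally constant. -/
lemma eventually_preservesOrientationAt_iff {P Q : CompactOriented I} {g : P → Q}
    (hg : ContMDiff I I ∞ g) (x : P) (hx : Function.Injective (mfderiv I I g x)) :
    ∀ᶠ y in 𝓝 x, (PreservesOrientationAt P Q g y ↔ PreservesOrientationAt P Q g x) := by
  let E := EuclideanSpace ℝ (Fin n)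
  let A : P → E →L[ℝ] E := inTangentCoordinates I I id g (mfderiv I I g) x
  have hA : ContinuousAt A x :=
    ((hg x).mfderiv_const (m := 0) (by simp)).continuousAt
  have hAeq : ∀ y ∈ (chartAt H x).source, g y ∈ (chartAt H (g x)).source → ∀ v : E,
      A y v = tangentCoordChange I (g y) (g x) (g y)
        (mfderiv I I g y (tangentCoordChange I x y y v)) := by
    intro y hy hy' v
    have := inTangentCoordinates_eq (I := I) (I' := I) (f := id) (g := g)
      (ϕ := fun y => (mfderiv I I g y : E →L[ℝ] E)) (x₀ := x) (x := y) hy hy'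
    exact congrArg (fun L : E →L[ℝ] E => L v) this
  have hAx : ∀ v : E, A x v = mfderiv I I g x v := by
    intro v
    rw [hAeq x (mem_chart_source H x) (mem_chart_source H (g x)),
      tangentCoordChange_self (by simp)]
    exact tangentCoordChange_self (by simp)
  let oP : Orientation ℝ E (Fin n) := P.orient x
  let oQ : Orientation ℝ E (Fin n) := Q.orient (g x)
  let F : P → ℝ := fun y => oQ.someVector (fun i => A y (stdBasis n i))
  have hF : ContinuousAt F x := by
    have h1 : F = fun y => oQ.someVector (stdBasis n) * (A y).det := by
      funext y
      refine (alternating_apply_eq (stdBasis n) oQ.someVector _).trans ?_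
      have h2 := (stdBasis n).det_comp (A y).toLinearMap (stdBasis n)
      rw [(stdBasis n).det_self, mul_one] at h2
      exact congrArg _ h2
    rw [h1]
    exact continuousAt_const.mul (ContinuousLinearMap.continuous_det.continuousAt.comp hA)
  have hF0 : SignType.sign (F x) ≠ 0 := by
    have h1 : LinearIndependent ℝ (fun i => A x (stdBasis n i)) := by
      refine (stdBasis n).linearIndependent.map' (A x : E →ₗ[ℝ] E)
        (LinearMap.ker_eq_bot.2 fun v w h => hx ?_)
      exact (hAx v).symm.trans (Eq.trans h (hAx w))
    exact orientSign_ne_zero_of_linearIndependent (stdBasis n) oQ h1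
  have hFs : ∀ᶠ y in 𝓝 x, SignType.sign (F y) = SignType.sign (F x) := by
    rcases lt_trichotomy (F x) 0 with h | h | h
    · filter_upwards [hF.eventually_lt_const h] with y hy
      rw [sign_neg hy, sign_neg h]
    · rw [h, sign_zero] at hF0
      exact absurd rfl hF0
    · filter_upwards [hF.eventually_const_lt h] with y hy
      rw [sign_pos hy, sign_pos h]
  have hpres : ∀ y ∈ (chartAt H x).source, g y ∈ (chartAt H (g x)).source →
      (∀ v : Fin n → TangentSpace I y,
        orientSign (P.orient x) (fun i => tangentCoordChange I y x y (v i)) =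
          orientSign (P.orient y) v) →
      (∀ v : Fin n → TangentSpace I (g y),
        orientSign (Q.orient (g x)) (fun i => tangentCoordChange I (g y) (g x) (g y) (v i)) =
          orientSign (Q.orient (g y)) v) →
      (PreservesOrientationAt P Q g y ↔ SignType.sign (F y) = orientSign oP (stdBasis n)) := by
    intro y hy hy' h1 h2
    have e1 : ∀ v : E, tangentCoordChange I y x y (tangentCoordChange I x y y v) = v := fun v => by
      rw [tangentCoordChange_comp (by simp [hy]), tangentCoordChange_self (by simpa using hy)]
    have e2 : ∀ v : E, tangentCoordChange I x y y (tangentCoordChange I y x y v) = v := fun v => by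
      rw [tangentCoordChange_comp (by simp [hy]), tangentCoordChange_self (by simp)]
    exact preserves_iff_of_conj (V := E) (W := E) (stdBasis n) (oPx := oP) (oPy := P.orient y)
      (oQx := oQ) (oQy := Q.orient (g y)) (TP := (tangentCoordChange I y x y).toLinearMap)
      (TP' := (tangentCoordChange I x y y).toLinearMap)
      (TQ := (tangentCoordChange I (g y) (g x) (g y)).toLinearMap)
      (D := (mfderiv I I g y).toLinearMap) (A := (A y).toLinearMap)
      (hAeq y hy hy') e1 e2 h1 h2
  have hP := P.orient_locally_constant x
  have hQ := (hg.continuous.tendsto x).eventually (Q.orient_locally_constant (g x))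
  have hc1 : ∀ᶠ y in 𝓝 x, y ∈ (chartAt H x).source := chart_source_mem_nhds H x
  have hc2 : ∀ᶠ y in 𝓝 x, g y ∈ (chartAt H (g x)).source :=
    (hg.continuous.tendsto x).eventually (chart_source_mem_nhds H (g x))
  filter_upwards [hP, hQ, hc1, hc2, hFs] with y h1 h2 h3 h4 h5
  rw [hpres y h3 h4 h1 h2, hpres x (mem_chart_source H x) (mem_chart_source H (g x))
    hP.self_of_nhds hQ.self_of_nhds, h5]

lemma isClopen_preservesOrientationAt {P Q : CompactOriented I} {g : P → Q}
    (hg : ContMDiff I I ∞ g) (hx : ∀ x, Function.Injective (mfderiv I I g x)) :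
    IsClopen {x | PreservesOrientationAt P Q g x} := by
  constructor
  · rw [← isOpen_compl_iff, isOpen_iff_mem_nhds]
    intro x h
    filter_upwards [eventually_preservesOrientationAt_iff hg x (hx x)] with y hy
    exact fun h' => h (hy.1 h')
  · rw [isOpen_iff_mem_nhds]
    intro x h
    filter_upwards [eventually_preservesOrientationAt_iff hg x (hx x)] with y hy
    exact hy.2 h

lemma PreservesOrientationAt.of_eq {P Q : CompactOriented I} {g : P → Q} {x : P}
    {v₀ : Fin n → TangentSpace I x} (h₀ : orientSign (P.orient x) v₀ ≠ 0)
    (h : orientSign (Q.orient (g x)) (fun i => mfderiv I I g x (v₀ i)) =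
      orientSign (P.orient x) v₀) : PreservesOrientationAt P Q g x :=
  fun v => orientSign_map_eq_of_eq (stdBasis n) (V := EuclideanSpace ℝ (Fin n))
    (W := EuclideanSpace ℝ (Fin n)) ((mfderiv I I g x).toLinearMap) (P.orient x)
    (Q.orient (g x)) h₀ h v

end PreservesAt

/-! ### Change of the model space -/

section ModelTransfer

variable {E E' H H' M : Type} [NormedAddCommGroup E] [NormedSpace ℝ E] [NormedAddCommGroup E']
  [NormedSpace ℝ E'] [TopologicalSpace H] [TopologicalSpace H'] [TopologicalSpace M]
  {I : ModelWithCorners ℝ E H} {I' : ModelWithCorners ℝ E' H'}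

/-- A manifold modelled on `H`, regarded as a manifold modelled on a homeomorphic space. -/
@[reducible]
def transferChartedSpace (h : H ≃ₜ H') (M : Type) [TopologicalSpace M] [ChartedSpace H M] :
    ChartedSpace H' M where
  atlas := (fun e => e.transHomeomorph h) '' atlas H M
  chartAt x := (chartAt H x).transHomeomorph h
  mem_chart_source x := mem_chart_source H x
  chart_mem_atlas x := ⟨_, chart_mem_atlas H x, rfl⟩

variable {h : H ≃ₜ H'} {L : E ≃L[ℝ] E'}

lemma mem_range_transfer (hL : ∀ z, I' (h z) = L (I z))
    {z : E'} : z ∈ Set.range I' ↔ L.symm z ∈ Set.range I := by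
  constructor
  · rintro ⟨w, rfl⟩
    refine ⟨h.symm w, ?_⟩
    rw [ContinuousLinearEquiv.eq_symm_apply, ← hL, h.apply_symm_apply]
  · rintro ⟨w, hw⟩
    refine ⟨h w, ?_⟩
    rw [hL, hw, L.apply_symm_apply]

/-- The restriction to the range matters: elsewhere the inverses of the two models take default
values that need not correspond. -/
lemma transfer_symm_apply (hL : ∀ z, I' (h z) = L (I z))
    {z : E'} (hz : z ∈ Set.range I') :
    h.symm (I'.symm z) = I.symm (L.symm z) := by
  obtain ⟨w, hw⟩ := (mem_range_transfer hL).1 hz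
  have : z = I' (h w) := by rw [hL, hw, L.apply_symm_apply]
  rw [← hw, this, I'.left_inv, I.left_inv, h.symm_apply_apply]

/-- On the range of the model, the new transition maps are the old ones conjugated by `L`. This
turns `S × [0,1]`, which is modelled on a product, into a manifold modelled on the half-space, as
cobordisms require. -/
lemma isManifold_transfer (hL : ∀ z, I' (h z) = L (I z))
    [ChartedSpace H M] [IsManifold I ∞ M] :
    letI := transferChartedSpace h M
    IsManifold I' ∞ M := by
  let := transferChartedSpace h M
  refine isManifold_of_contDiffOn I' ∞ M ?_
  rintro _ _ ⟨e, he, rfl⟩ ⟨e', he', rfl⟩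
  have h1 : ContDiffOn ℝ ∞ (I ∘ e.symm.trans e' ∘ I.symm)
      (I.symm ⁻¹' (e.symm.trans e').source ∩ Set.range I) :=
    (contDiffGroupoid ∞ I).compatible he he' |>.1
  have h2 := (L.contDiff.comp_contDiffOn h1).comp
    (s := I'.symm ⁻¹' ((e.transHomeomorph h).symm.trans (e'.transHomeomorph h)).source ∩
      Set.range I') L.symm.contDiff.contDiffOn ?_
  · refine h2.congr fun z hz => ?_
    have := transfer_symm_apply hL hz.2
    simp [this, hL]
  · rintro z ⟨hz, hz'⟩
    refine ⟨?_, (mem_range_transfer hL).1 hz'⟩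
    have := transfer_symm_apply hL hz'
    simpa [this] using hz

lemma extChartAt_transfer (hL : ∀ z, I' (h z) = L (I z))
    [ChartedSpace H M] (x y : M) :
    letI := transferChartedSpace h M
    extChartAt I' x y = L (extChartAt I x y) :=
  hL _

lemma extChartAt_transfer_symm (hL : ∀ z, I' (h z) = L (I z))
    [ChartedSpace H M] (x : M) {z : E'} (hz : z ∈ Set.range I') :
    letI := transferChartedSpace h M
    (extChartAt I' x).symm z = (extChartAt I x).symm (L.symm z) :=
  congrArg (chartAt H x).symm (transfer_symm_apply hL hz)

lemma contMDiff_transfer (hL : ∀ z, I' (h z) = L (I z))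
    [ChartedSpace H M] [IsManifold I ∞ M] :
    letI := transferChartedSpace h M
    ContMDiff I I' ∞ (fun x : M => x) := by
  let := transferChartedSpace h M
  intro x
  rw [contMDiffAt_iff]
  refine ⟨continuousAt_id, ?_⟩
  refine L.contDiff.contDiffWithinAt.congr_of_eventuallyEq_of_mem ?_ (by simp)
  filter_upwards [extChartAt_target_mem_nhdsWithin (I := I) x] with z hz
  refine (extChartAt_transfer hL x _).trans ?_
  change L (extChartAt I x ((extChartAt I x).symm z)) = L z
  rw [(extChartAt I x).right_inv hz]

lemma contMDiff_transfer_symm (hL : ∀ z, I' (h z) = L (I z))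
    [ChartedSpace H M] [IsManifold I ∞ M] :
    letI := transferChartedSpace h M
    ContMDiff I' I ∞ (fun x : M => x) := by
  let := transferChartedSpace h M
  intro x
  rw [contMDiffAt_iff]
  refine ⟨continuousAt_id, ?_⟩
  refine L.symm.contDiff.contDiffWithinAt.congr_of_eventuallyEq_of_mem ?_ (by simp)
  filter_upwards [extChartAt_target_mem_nhdsWithin (I := I') x] with z hz
  have h1 := extChartAt_transfer hL x ((extChartAt I' x).symm z)
  rw [(extChartAt I' x).right_inv hz] at h1
  change extChartAt I x ((extChartAt I' x).symm z) = L.symm z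
  rw [h1, L.symm_apply_apply, ← h1]

/-- Conjugation by `L` does not change determinants, so the orientation of the cylinder can be
checked in the product model. -/
lemma tangentCoordChange_transfer (hL : ∀ z, I' (h z) = L (I z))
    [ChartedSpace H M] [IsManifold I ∞ M] {x y z : M}
    (hz : z ∈ (extChartAt I x).source ∩ (extChartAt I y).source) :
    letI := transferChartedSpace h M
    haveI : IsManifold I' ∞ M := isManifold_transfer hL
    tangentCoordChange I' x y z =
      (L : E →L[ℝ] E').comp ((tangentCoordChange I x y z).comp (L.symm : E' →L[ℝ] E)) := by
  let := transferChartedSpace h M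
  have : IsManifold I' ∞ M := isManifold_transfer hL
  rw [tangentCoordChange_def]
  have hx : extChartAt I' x z = L (extChartAt I x z) := extChartAt_transfer hL x z
  refine HasFDerivWithinAt.fderivWithin ?_ (I'.uniqueDiffOn _ ?_)
  · have h1 := hasFDerivWithinAt_tangentCoordChange hz
    have h2 : HasFDerivWithinAt L.symm (L.symm : E' →L[ℝ] E) (Set.range I')
        (extChartAt I' x z) := L.symm.hasFDerivWithinAt
    have h3 : HasFDerivWithinAt ((extChartAt I y ∘ (extChartAt I x).symm) ∘ L.symm)
        ((tangentCoordChange I x y z).comp (L.symm : E' →L[ℝ] E)) (Set.range I')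
        (extChartAt I' x z) := by
      refine HasFDerivWithinAt.comp (g := extChartAt I y ∘ (extChartAt I x).symm) (t := Set.range I) _ ?_ h2
        fun w hw => (mem_range_transfer hL).1 hw
      rw [hx, L.symm_apply_apply]
      exact h1
    have h4 := (L.hasFDerivAt.comp_hasFDerivWithinAt _ h3)
    refine h4.congr (fun w hw => ?_) ?_
    · refine (extChartAt_transfer hL y _).trans ?_
      rw [extChartAt_transfer_symm hL x hw]
      rfl
    · refine (extChartAt_transfer hL y _).trans ?_
      rw [extChartAt_transfer_symm hL x (show extChartAt I' x z ∈ Set.range I' from ⟨_, rfl⟩)]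
      rfl
  · exact ⟨_, rfl⟩

end ModelTransfer

/-! ### Coordinate changes of products -/

lemma fderivWithin_prodMap {E E' F F' : Type} [NormedAddCommGroup E] [NormedSpace ℝ E]
    [NormedAddCommGroup E'] [NormedSpace ℝ E'] [NormedAddCommGroup F] [NormedSpace ℝ F]
    [NormedAddCommGroup F'] [NormedSpace ℝ F'] {f : E → F} {g : E' → F'} {f' : E →L[ℝ] F}
    {g' : E' →L[ℝ] F'} {s : Set E} {t : Set E'} {x : E} {y : E'}
    (hf : HasFDerivWithinAt f f' s x) (hg : HasFDerivWithinAt g g' t y)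
    (hs : UniqueDiffWithinAt ℝ s x) (ht : UniqueDiffWithinAt ℝ t y) :
    fderivWithin ℝ (Prod.map f g) (s ×ˢ t) (x, y) = f'.prodMap g' := by
  have h : HasFDerivWithinAt (Prod.map f g) (f'.prodMap g') (s ×ˢ t) (x, y) :=
    (hf.comp (x, y) hasFDerivWithinAt_fst fun z hz => hz.1).prodMk
      (hg.comp (x, y) hasFDerivWithinAt_snd fun z hz => hz.2)
  exact h.fderivWithin (hs.prod ht)

lemma tangentCoordChange_prod {E E' H H' M N : Type} [NormedAddCommGroup E] [NormedSpace ℝ E]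
    [NormedAddCommGroup E'] [NormedSpace ℝ E'] [TopologicalSpace H] [TopologicalSpace H']
    [TopologicalSpace M] [TopologicalSpace N] {I : ModelWithCorners ℝ E H}
    {J : ModelWithCorners ℝ E' H'} [ChartedSpace H M] [ChartedSpace H' N] [IsManifold I ∞ M]
    [IsManifold J ∞ N] {p q r : M × N}
    (h : r ∈ (extChartAt (I.prod J) p).source ∩ (extChartAt (I.prod J) q).source) :
    tangentCoordChange (I.prod J) p q r =
      (tangentCoordChange I p.1 q.1 r.1).prodMap (tangentCoordChange J p.2 q.2 r.2) := by
  rw [extChartAt_prod, extChartAt_prod] at h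
  have h1 := hasFDerivWithinAt_tangentCoordChange (I := I) (x := p.1) (y := q.1) (z := r.1)
    ⟨h.1.1, h.2.1⟩
  have h2 := hasFDerivWithinAt_tangentCoordChange (I := J) (x := p.2) (y := q.2) (z := r.2)
    ⟨h.1.2, h.2.2⟩
  have h5 : Set.range (I.prod J) = Set.range I ×ˢ Set.range J := by
    rw [modelWithCorners_prod_coe, Set.range_prodMap]
  have h3 := fderivWithin_prodMap h1 h2 (I.uniqueDiffOn _ (Set.mem_range_self _))
    (J.uniqueDiffOn _ (Set.mem_range_self _))
  rw [tangentCoordChange_def, h5, extChartAt_prod, extChartAt_prod]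
  exact h3

/-! ### Coordinate changes of the interval -/

/-- The sign of the preferred chart at a point of the interval. -/
def iccSign (t : Set.Icc (0 : ℝ) 1) : SignType := if t.val < 1 then 1 else -1

lemma iccSign_ne_zero (t : Set.Icc (0 : ℝ) 1) : iccSign t ≠ 0 := by
  unfold iccSign
  split_ifs <;> decide

lemma chartAt_Icc_of_lt {t : Set.Icc (0 : ℝ) 1} (h : t.val < 1) :
    chartAt (EuclideanHalfSpace 1) t = IccLeftChart 0 1 :=
  if_pos h

lemma chartAt_Icc_of_not_lt {t : Set.Icc (0 : ℝ) 1} (h : ¬ t.val < 1) :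
    chartAt (EuclideanHalfSpace 1) t = IccRightChart 0 1 :=
  if_neg h

lemma tangentCoordChange_Icc_of_iff {s t : Set.Icc (0 : ℝ) 1} (h : s.val < 1 ↔ t.val < 1) :
    tangentCoordChange (𝓡∂ 1) s t s = ContinuousLinearMap.id ℝ (EuclideanSpace ℝ (Fin 1)) := by
  have h1 : extChartAt (𝓡∂ 1) t = extChartAt (𝓡∂ 1) s := by
    have : chartAt (EuclideanHalfSpace 1) t = chartAt (EuclideanHalfSpace 1) s := by
      by_cases hs : s.val < 1
      · rw [chartAt_Icc_of_lt hs, chartAt_Icc_of_lt (h.1 hs)]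
      · rw [chartAt_Icc_of_not_lt hs, chartAt_Icc_of_not_lt (fun h' => hs (h.2 h'))]
    rw [extChartAt, this, ← extChartAt]
  rw [tangentCoordChange_def, h1, ← tangentCoordChange_def]
  ext v : 1
  exact tangentCoordChange_self (mem_extChartAt_source s)

/-- The left chart is `s ↦ s` and the right chart is `s ↦ 1 - s`, so the change of coordinates is `z
↦ 1 - z`. -/
lemma tangentCoordChange_Icc_left_right {s t : Set.Icc (0 : ℝ) 1} (hs : s.val < 1)
    (ht : ¬ t.val < 1) :
    tangentCoordChange (𝓡∂ 1) s t s = -ContinuousLinearMap.id ℝ (EuclideanSpace ℝ (Fin 1)) := by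
  -- The inverse charts clip the coordinate to `[0,1]`, so the formula is available only within
  -- these bounds; they hold near `s` inside the range of the model.
  have key : ∀ z : EuclideanSpace ℝ (Fin 1), 0 ≤ z 0 → z 0 < 1 →
      (extChartAt (𝓡∂ 1) t ∘ (extChartAt (𝓡∂ 1) s).symm) z = WithLp.toLp 2 (fun _ => 1) - z := by
    intro z h0 h1
    have h2 : extChartAt (𝓡∂ 1) t ((extChartAt (𝓡∂ 1) s).symm z) =
        (IccRightChart 0 1 ((IccLeftChart 0 1).symm ((𝓡∂ 1).symm z))).val := by
      simp only [extChartAt, chartAt_Icc_of_lt hs, chartAt_Icc_of_not_lt ht]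
      rfl
    refine h2.trans ?_
    ext i
    rw [Subsingleton.elim i 0]
    have h3 : ((𝓡∂ 1).symm z).val 0 = z 0 := by
      rw [modelWithCornersEuclideanHalfSpace_symm_apply]
      simp [h0]
    change 1 - min (((𝓡∂ 1).symm z).val 0 + 0) 1 = 1 - z 0
    rw [h3, add_zero, min_eq_left h1.le]
  have hz : extChartAt (𝓡∂ 1) s s 0 = s.val := by
    simp only [extChartAt, chartAt_Icc_of_lt hs]
    exact sub_zero s.val
  rw [tangentCoordChange_def]
  refine HasFDerivWithinAt.fderivWithin ?_ ((𝓡∂ 1).uniqueDiffOn _ (Set.mem_range_self _))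
  have h1 : HasFDerivWithinAt (fun z : EuclideanSpace ℝ (Fin 1) =>
      (WithLp.toLp 2 (fun _ => 1) : EuclideanSpace ℝ (Fin 1)) - z)
      (-ContinuousLinearMap.id ℝ (EuclideanSpace ℝ (Fin 1))) (Set.range (𝓡∂ 1))
      (extChartAt (𝓡∂ 1) s s) := (hasFDerivWithinAt_id _ _).const_sub _
  refine h1.congr_of_eventuallyEq ?_ (key _ (hz ▸ s.2.1) (hz ▸ hs))
  have hlt : ∀ᶠ z : EuclideanSpace ℝ (Fin 1) in 𝓝 (extChartAt (𝓡∂ 1) s s), z 0 < 1 := by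
    have hc : ContinuousAt (fun z : EuclideanSpace ℝ (Fin 1) => z 0) (extChartAt (𝓡∂ 1) s s) := by
      fun_prop
    exact hc.eventually_lt_const (hz.trans_lt hs)
  filter_upwards [nhdsWithin_le_nhds hlt, self_mem_nhdsWithin] with z h2 h3
  refine key z ?_ h2
  rwa [range_modelWithCornersEuclideanHalfSpace] at h3

/-- Only the endpoint `1` has the right chart as its preferred chart. Near any other point all
preferred charts agree; at `1` the sign `-1` cancels against the derivative `-1` of the coordinate
change. -/
lemma eventually_iccSign_eq (t : Set.Icc (0 : ℝ) 1) : ∀ᶠ s in 𝓝 t,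
    iccSign t * SignType.sign (tangentCoordChange (𝓡∂ 1) s t s).det = iccSign s := by
  have hone : SignType.sign (ContinuousLinearMap.id ℝ (EuclideanSpace ℝ (Fin 1))).det = 1 := by
    simp [ContinuousLinearMap.det]
  have hneg : SignType.sign (-ContinuousLinearMap.id ℝ (EuclideanSpace ℝ (Fin 1))).det = -1 := by
    have : (-ContinuousLinearMap.id ℝ (EuclideanSpace ℝ (Fin 1))).det = -1 := by
      have h := LinearMap.det_smul (-1 : ℝ) (LinearMap.id (R := ℝ) (M := EuclideanSpace ℝ (Fin 1)))
      rw [LinearMap.det_id, mul_one, finrank_euclideanSpace_fin, pow_one, neg_one_smul] at h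
      exact h
    rw [this]
    simp
  by_cases ht : t.val < 1
  · have h1 : ∀ᶠ s : Set.Icc (0 : ℝ) 1 in 𝓝 t, s.val < 1 :=
      continuous_subtype_val.continuousAt.eventually_lt_const ht
    filter_upwards [h1] with s hs
    rw [tangentCoordChange_Icc_of_iff (by simp [hs, ht]), hone]
    simp [iccSign, hs, ht]
  · refine Filter.Eventually.of_forall fun s => ?_
    by_cases hs : s.val < 1
    · rw [tangentCoordChange_Icc_left_right hs ht, hneg]
      simp [iccSign, hs, ht]
    · rw [tangentCoordChange_Icc_of_iff (by simp [hs, ht]), hone]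
      simp [iccSign, hs, ht]

/-! ### The half-space as a product -/

/-- `ℝᵈ × ℝ ≃ ℝᵈ⁺¹`, with the last factor as the first coordinate. -/
def consEquiv (d : ℕ) : (EuclideanSpace ℝ (Fin d) × EuclideanSpace ℝ (Fin 1)) ≃L[ℝ]
    EuclideanSpace ℝ (Fin (d + 1)) :=
  LinearEquiv.toContinuousLinearEquiv
    { toFun := fun p => WithLp.toLp 2 (Fin.cons (p.2 0) p.1)
      invFun := fun z => (WithLp.toLp 2 fun i => z i.succ, WithLp.toLp 2 fun _ => z 0)
      map_add' := fun p q => by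
        ext i
        refine Fin.cases ?_ (fun i => ?_) i <;> simp
      map_smul' := fun c p => by
        ext i
        refine Fin.cases ?_ (fun i => ?_) i <;> simp
      left_inv := fun p => by
        ext i
        · simp
        · rw [Subsingleton.elim i 0]
          simp
      right_inv := fun z => by
        ext i
        refine Fin.cases ?_ (fun i => ?_) i <;> simp }

/-- `ℝᵈ × [0,∞) ≃ {z ∈ ℝᵈ⁺¹ | 0 ≤ z 0}`. -/
def halfSpaceHomeomorph (d : ℕ) :
    ModelProd (EuclideanSpace ℝ (Fin d)) (EuclideanHalfSpace 1) ≃ₜ EuclideanHalfSpace (d + 1) where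
  toFun p := ⟨consEquiv d (p.1, p.2.val), p.2.2⟩
  invFun z := (((consEquiv d).symm z.val).1, ⟨((consEquiv d).symm z.val).2, z.2⟩)
  left_inv p := by
    have h := (consEquiv d).symm_apply_apply (p.1, p.2.val)
    have h1 := congrArg Prod.fst h
    have h2 := congrArg Prod.snd h
    exact Prod.ext h1 (Subtype.ext h2)
  right_inv z := Subtype.ext ((consEquiv d).apply_symm_apply z.val)
  continuous_toFun := ((consEquiv d).continuous.comp
    (continuous_fst.prodMk (continuous_subtype_val.comp continuous_snd))).subtype_mk _
  continuous_invFun := by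
    have h := (consEquiv d).symm.continuous.comp
      (continuous_subtype_val (p := fun z : EuclideanSpace ℝ (Fin (d + 1)) => 0 ≤ z 0))
    exact (continuous_fst.comp h).prodMk ((continuous_snd.comp h).subtype_mk _)

lemma halfSpaceHomeomorph_apply (d : ℕ)
    (p : ModelProd (EuclideanSpace ℝ (Fin d)) (EuclideanHalfSpace 1)) :
    (𝓡∂ (d + 1)) (halfSpaceHomeomorph d p) = consEquiv d (((𝓡 d).prod (𝓡∂ 1)) p) := rfl

/-- The row of zeroth coordinates is `(v 0, 0, …, 0)`, so expansion along it leaves the minor formed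
by `w`. -/
lemma det_vecCons {d : ℕ} (v : EuclideanSpace ℝ (Fin (d + 1)))
    (w : Fin d → EuclideanSpace ℝ (Fin d)) :
    (stdBasis (d + 1)).det (Matrix.vecCons v fun i => consEquiv d (w i, 0)) =
      v 0 * (stdBasis d).det w := by
  rw [Module.Basis.det_apply, Module.Basis.det_apply, Matrix.det_succ_row_zero,
    Finset.sum_eq_single 0]
  · simp only [Fin.val_zero, pow_zero, one_mul, Fin.succAbove_zero]
    congr 1
  · intro j _ hj
    obtain ⟨i, rfl⟩ := Fin.exists_succ_eq.2 hj
    have : (stdBasis (d + 1)).toMatrix (Matrix.vecCons v fun i => consEquiv d (w i, 0)) 0 i.succ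
        = 0 := rfl
    rw [this]
    simp
  · simp

/-! ### The cylinder -/

section Cylinder

variable {d : ℕ} (S : ClosedManifold d)

lemma orientSign_map {V : Type*} [AddCommGroup V] [Module ℝ V] {n : ℕ}
    (b : Module.Basis (Fin n) ℝ V) (o : Orientation ℝ V (Fin n)) (A : V →ₗ[ℝ] V)
    (v : Fin n → V) :
    orientSign o (fun i => A (v i)) = orientSign o v * SignType.sign (LinearMap.det A) := by
  rw [orientSign_eq b o, orientSign_eq b o v]
  have h : b.det (fun i => A (v i)) = LinearMap.det A * b.det v := b.det_comp A v
  rw [h, sign_mul, mul_assoc, mul_comm (SignType.sign (LinearMap.det A))]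

/-- The sign of the standard basis at a point of the cylinder. -/
def cylinderSign (p : S × Set.Icc (0 : ℝ) 1) : SignType :=
  iccSign p.2 * orientSign (S.orient p.1) (stdBasis d)

variable {S} in
lemma cylinderSign_ne_zero (p : S × Set.Icc (0 : ℝ) 1) : cylinderSign S p ≠ 0 :=
  mul_ne_zero (iccSign_ne_zero _) (orientSign_basis_ne_zero _ _)

/-- The charts of the cylinder, with values in the half-space. -/
@[reducible]
def cylinderChartedSpace : ChartedSpace (EuclideanHalfSpace (d + 1)) (S × Set.Icc (0 : ℝ) 1) :=
  transferChartedSpace (halfSpaceHomeomorph d) _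

lemma isManifold_cylinder :
    @IsManifold _ _ _ _ _ _ _ (𝓡∂ (d + 1)) ∞ (S × Set.Icc (0 : ℝ) 1) _
      (cylinderChartedSpace S) :=
  isManifold_transfer (I := (𝓡 d).prod (𝓡∂ 1)) (halfSpaceHomeomorph_apply d)

/-- The coordinate change is conjugate to the product of those of `S` and of the interval. Its
determinant is therefore a product, and each factor accounts for the sign of its own orientation. -/
lemma eventually_cylinderSign_eq (p : S × Set.Icc (0 : ℝ) 1) :
    letI := cylinderChartedSpace S
    haveI := isManifold_cylinder S
    ∀ᶠ q in 𝓝 p, cylinderSign S p *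
      SignType.sign (tangentCoordChange (𝓡∂ (d + 1)) q p q).det = cylinderSign S q := by
  let := cylinderChartedSpace S
  have := isManifold_cylinder S
  have h1 := (continuous_fst.tendsto p).eventually (S.orient_locally_constant p.1)
  have h2 := (continuous_snd.tendsto p).eventually (eventually_iccSign_eq p.2)
  have h3 : ∀ᶠ q in 𝓝 p, q ∈ (extChartAt ((𝓡 d).prod (𝓡∂ 1)) p).source :=
    extChartAt_source_mem_nhds p
  filter_upwards [h1, h2, h3] with q h1 h2 h3
  have e1 : tangentCoordChange (𝓡∂ (d + 1)) q p q = _ :=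
    tangentCoordChange_transfer (I := (𝓡 d).prod (𝓡∂ 1)) (halfSpaceHomeomorph_apply d)
      ⟨mem_extChartAt_source q, h3⟩
  rw [tangentCoordChange_prod ⟨mem_extChartAt_source q, h3⟩] at e1
  have e2 : (tangentCoordChange (𝓡∂ (d + 1)) q p q).det =
      (tangentCoordChange (𝓡 d) q.1 p.1 q.1).det *
        (tangentCoordChange (𝓡∂ 1) q.2 p.2 q.2).det := by
    rw [e1]
    refine (LinearMap.det_conj _ (consEquiv d).toLinearEquiv).trans ?_
    exact LinearMap.det_prodMap _ _
  have e3 := orientSign_map (V := EuclideanSpace ℝ (Fin d)) (stdBasis d) (S.orient p.1)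
    (tangentCoordChange (𝓡 d) q.1 p.1 q.1).toLinearMap (stdBasis d)
  have e4 : orientSign (V := EuclideanSpace ℝ (Fin d)) (S.orient p.1)
      (fun i => (tangentCoordChange (𝓡 d) q.1 p.1 q.1) (stdBasis d i)) =
      orientSign (V := EuclideanSpace ℝ (Fin d)) (S.orient q.1) (stdBasis d) :=
    h1 (stdBasis d)
  have e5 := e4.symm.trans e3
  unfold cylinderSign
  rw [e2, sign_mul, ← h2]
  refine Eq.trans ?_ (congrArg (fun s => iccSign p.2 *
    SignType.sign (tangentCoordChange (𝓡∂ 1) q.2 p.2 q.2).det * s) e5.symm)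
  have comm : ∀ a b c e : SignType, a * b * (c * e) = a * e * (b * c) := by decide
  exact comm _ _ _ _

/-- The cylinder `S × [0,1]`. -/
def cylinderManifold : ManifoldWithBoundary d :=
  letI := cylinderChartedSpace S
  haveI := isManifold_cylinder S
  { carrier := S × Set.Icc (0 : ℝ) 1
    orient := fun p => orientationOfSign (V := EuclideanSpace ℝ (Fin (d + 1))) (stdBasis (d + 1))
      (cylinderSign S p)
    orient_locally_constant := fun p => by
      filter_upwards [eventually_cylinderSign_eq S p] with q hq v
      refine (orientSign_map (V := EuclideanSpace ℝ (Fin (d + 1))) (stdBasis (d + 1)) _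
        (tangentCoordChange (𝓡∂ (d + 1)) q p q).toLinearMap v).trans ?_
      refine Eq.trans ?_ (orientSign_orientationOfSign (V := EuclideanSpace ℝ (Fin (d + 1)))
        (stdBasis (d + 1)) (cylinderSign_ne_zero q) v).symm
      refine (congrArg (fun s => s * _) (orientSign_orientationOfSign
        (V := EuclideanSpace ℝ (Fin (d + 1))) (stdBasis (d + 1))
        (cylinderSign_ne_zero p) v)).trans ?_
      rw [← hq]
      exact mul_right_comm (G := SignType) _ _ _ }

/-- The identity map from `S × [0,1]` with the product structure to the cylinder. -/
def toCylinder : S × Set.Icc (0 : ℝ) 1 → cylinderManifold S := fun p => p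

/-- The identity map from the cylinder to `S × [0,1]` with the product structure. -/
def ofCylinder : cylinderManifold S → S × Set.Icc (0 : ℝ) 1 := fun p => p

lemma contMDiff_toCylinder :
    ContMDiff ((𝓡 d).prod (𝓡∂ 1)) (𝓡∂ (d + 1)) ∞ (toCylinder S) :=
  contMDiff_transfer (M := S × Set.Icc (0 : ℝ) 1) (I := (𝓡 d).prod (𝓡∂ 1)) (halfSpaceHomeomorph_apply d)

lemma contMDiff_ofCylinder :
    ContMDiff (𝓡∂ (d + 1)) ((𝓡 d).prod (𝓡∂ 1)) ∞ (ofCylinder S) :=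
  contMDiff_transfer_symm (M := S × Set.Icc (0 : ℝ) 1) (I := (𝓡 d).prod (𝓡∂ 1)) (halfSpaceHomeomorph_apply d)

/-- The identity map as a diffeomorphism from `S × [0,1]` to the cylinder. -/
def cylinderDiffeomorph : Diffeomorph ((𝓡 d).prod (𝓡∂ 1)) (𝓡∂ (d + 1))
    (S × Set.Icc (0 : ℝ) 1) (cylinderManifold S) ∞ where
  toFun := toCylinder S
  invFun := ofCylinder S
  left_inv _ := rfl
  right_inv _ := rfl
  contMDiff_toFun := contMDiff_toCylinder S
  contMDiff_invFun := contMDiff_ofCylinder S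

lemma orientSign_cylinder (p : cylinderManifold S)
    (v : Fin (d + 1) → EuclideanSpace ℝ (Fin (d + 1))) :
    orientSign (V := EuclideanSpace ℝ (Fin (d + 1))) ((cylinderManifold S).orient p) v =
      cylinderSign S p * SignType.sign ((stdBasis (d + 1)).det v) :=
  orientSign_orientationOfSign _ (cylinderSign_ne_zero _) v

lemma extChartAt_cylinder (p q : S × Set.Icc (0 : ℝ) 1) :
    extChartAt (𝓡∂ (d + 1)) (toCylinder S p) (toCylinder S q) =
      consEquiv d (extChartAt (𝓡 d) p.1 q.1, extChartAt (𝓡∂ 1) p.2 q.2) := by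
  refine (extChartAt_transfer (I := (𝓡 d).prod (𝓡∂ 1)) (I' := 𝓡∂ (d + 1))
    (halfSpaceHomeomorph_apply d) p q).trans ?_
  rw [extChartAt_prod]
  rfl

lemma extChartAt_Icc_self_eq_zero_iff (t : Set.Icc (0 : ℝ) 1) :
    extChartAt (𝓡∂ 1) t t 0 = 0 ↔ t = 0 ∨ t = 1 := by
  by_cases h : t.val < 1
  · have h1 : extChartAt (𝓡∂ 1) t t 0 = t.val - 0 := by
      simp only [extChartAt, chartAt_Icc_of_lt h]
      rfl
    have h2 : t ≠ 1 := fun e => by simp [e] at h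
    rw [h1, sub_zero]
    exact ⟨fun h => Or.inl (Subtype.ext h), fun h => congrArg Subtype.val (h.resolve_right h2)⟩
  · have h1 : extChartAt (𝓡∂ 1) t t 0 = 1 - t.val := by
      simp only [extChartAt, chartAt_Icc_of_not_lt h]
      rfl
    have h2 : t = 1 := Subtype.ext (le_antisymm t.2.2 (not_lt.1 h))
    rw [h1, h2]
    simp

/-- The zeroth coordinate of a point in its preferred chart is the chart coordinate on the interval,
which vanishes exactly at the two ends. -/
lemma cylinder_boundary :
    (𝓡∂ (d + 1)).boundary (cylinderManifold S) =
      Set.range (fun x : S => toCylinder S (x, 0)) ∪ Set.range fun x : S => toCylinder S (x, 1) := by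
  ext p
  obtain ⟨x, t⟩ := p
  have h1 : (𝓡∂ (d + 1)).IsBoundaryPoint (toCylinder S (x, t)) ↔ t = 0 ∨ t = 1 := by
    rw [ModelWithCorners.isBoundaryPoint_iff, frontier_range_modelWithCornersEuclideanHalfSpace,
      extChartAt_cylinder, ← extChartAt_Icc_self_eq_zero_iff]
    exact eq_comm
  refine h1.trans ?_
  constructor
  · rintro (rfl | rfl)
    · exact Or.inl ⟨x, rfl⟩
    · exact Or.inr ⟨x, rfl⟩
  · rintro (⟨y, hy⟩ | ⟨y, hy⟩)
    · exact Or.inl (congrArg Prod.snd hy).symm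
    · exact Or.inr (congrArg Prod.snd hy).symm

lemma contMDiff_cylinder_slice (t : Set.Icc (0 : ℝ) 1) :
    ContMDiff (𝓡 d) (𝓡∂ (d + 1)) ∞ (fun x : S => toCylinder S (x, t)) :=
  (contMDiff_toCylinder S).comp (contMDiff_id.prodMk contMDiff_const)

/-- In preferred charts the slice is the affine map `z ↦ (z, constant)`. -/
lemma mfderiv_cylinder_slice (t : Set.Icc (0 : ℝ) 1) (x : S) (w : EuclideanSpace ℝ (Fin d)) :
    mfderiv (𝓡 d) (𝓡∂ (d + 1)) (fun x : S => toCylinder S (x, t)) x w =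
      consEquiv d (w, 0) := by
  have h := (contMDiff_cylinder_slice S t x).mdifferentiableAt (by simp)
  have h1 : HasFDerivWithinAt (fun z => consEquiv d (z, extChartAt (𝓡∂ 1) t t))
      ((consEquiv d : _ →L[ℝ] EuclideanSpace ℝ (Fin (d + 1))).comp
        (ContinuousLinearMap.inl ℝ (EuclideanSpace ℝ (Fin d)) (EuclideanSpace ℝ (Fin 1))))
      (Set.range (𝓡 d)) (extChartAt (𝓡 d) x x) :=
    (consEquiv d).hasFDerivAt.comp_hasFDerivWithinAt _
      (hasFDerivAt_prodMk_left _ _).hasFDerivWithinAt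
  have h2 : ∀ z ∈ (extChartAt (𝓡 d) x).target,
      writtenInExtChartAt (𝓡 d) (𝓡∂ (d + 1)) x (fun x : S => toCylinder S (x, t)) z =
        consEquiv d (z, extChartAt (𝓡∂ 1) t t) := fun z hz => by
    refine (extChartAt_cylinder S (x, t) ((extChartAt (𝓡 d) x).symm z, t)).trans ?_
    rw [(extChartAt (𝓡 d) x).right_inv hz]
  have h3 := h1.congr_of_eventuallyEq (f₁ := writtenInExtChartAt (𝓡 d) (𝓡∂ (d + 1)) x
    (fun x : S => toCylinder S (x, t)))
    (by filter_upwards [extChartAt_target_mem_nhdsWithin (I := 𝓡 d) x] with z hz using h2 z hz)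
    (h2 _ (mem_extChartAt_target x))
  have h4 := h.mfderiv.trans (h3.fderivWithin ((𝓡 d).uniqueDiffOn _ (Set.mem_range_self _)))
  exact congrArg (fun A : EuclideanSpace ℝ (Fin d) →L[ℝ] EuclideanSpace ℝ (Fin (d + 1)) => A w) h4

/-- This formula makes both ends of the cylinder obey the boundary conventions with the same
orientation of `S`: an inward vector at `0` contributes `1 * 1`, an outward vector at `1`
contributes `(-1) * (-1)`. -/
lemma orientSign_cylinder_slice (t : Set.Icc (0 : ℝ) 1) (x : S)
    (v : TangentSpace (𝓡∂ (d + 1)) (toCylinder S (x, t))) (w : Fin d → TangentSpace (𝓡 d) x) :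
    orientSign ((cylinderManifold S).orient (toCylinder S (x, t)))
      (Matrix.vecCons v (fun i =>
        mfderiv (𝓡 d) (𝓡∂ (d + 1)) (fun x : S => toCylinder S (x, t)) x (w i))) =
      iccSign t * SignType.sign ((show EuclideanSpace ℝ (Fin (d + 1)) from v) 0) *
        orientSign (S.orient x) w := by
  have e : (fun i => mfderiv (𝓡 d) (𝓡∂ (d + 1)) (fun x : S => toCylinder S (x, t)) x (w i)) =
      fun i => consEquiv d (w i, 0) := funext fun i => mfderiv_cylinder_slice S t x (w i)
  rw [e]
  refine (orientSign_cylinder S _ _).trans ?_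
  have e1 := det_vecCons (show EuclideanSpace ℝ (Fin (d + 1)) from v) w
  have e2 := orientSign_eq (V := EuclideanSpace ℝ (Fin d)) (stdBasis d) (S.orient x) w
  refine (congrArg (fun r => cylinderSign S (x, t) * SignType.sign r) e1).trans ?_
  refine Eq.trans ?_ (congrArg (fun r => iccSign t *
    SignType.sign ((show EuclideanSpace ℝ (Fin (d + 1)) from v) 0) * r) e2.symm)
  rw [sign_mul]
  exact mul_mul_mul_comm (G := SignType) _ _ _ _

/-- The cylinder as a cobordism from `S` to `S`. -/
def cylinder : Cobordism S S where
  bulk := cylinderManifold S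
  inMap x := toCylinder S (x, 0)
  outMap x := toCylinder S (x, 1)
  contMDiff_inMap := contMDiff_cylinder_slice S 0
  contMDiff_outMap := contMDiff_cylinder_slice S 1
  injective_inMap x y h := congrArg (fun p => (ofCylinder S p).1) h
  injective_outMap x y h := congrArg (fun p => (ofCylinder S p).1) h
  inMap_ne_outMap x y h := by
    have := congrArg (fun p => ((ofCylinder S p).2 : ℝ)) h
    exact zero_ne_one this
  boundary_eq := cylinder_boundary S
  orient_inMap x v w hv := by
    rw [orientSign_cylinder_slice, sign_pos hv]
    simp [iccSign]
  orient_outMap x v w hv := by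
    rw [orientSign_cylinder_slice, sign_neg hv]
    simp [iccSign]

end Cylinder

/-! ### A shift of the half-line that is the identity far away -/

/-- The derivative vanishes outside `[0,1]` and is bounded on `[0,1]` by compactness. -/
lemma exists_bound_deriv_smoothTransition :
    ∃ C : ℝ, ∀ x, deriv Real.smoothTransition x ≤ C := by
  have hc : Continuous (deriv Real.smoothTransition) :=
    (Real.smoothTransition.contDiff (n := 1)).continuous_deriv (by simp)
  obtain ⟨C, hC⟩ := (isCompact_Icc (a := (0 : ℝ)) (b := 1)).exists_bound_of_continuousOn
    hc.continuousOn
  have hC0 : 0 ≤ C := (norm_nonneg _).trans (hC 0 (by simp))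
  refine ⟨C, fun x => ?_⟩
  rcases lt_or_ge x 0 with h | h
  · have : Real.smoothTransition =ᶠ[𝓝 x] fun _ => 0 := by
      filter_upwards [gt_mem_nhds h] with y hy
      exact Real.smoothTransition.zero_of_nonpos hy.le
    rw [this.deriv_eq, deriv_const]
    exact hC0
  rcases lt_or_ge 1 x with h' | h'
  · have : Real.smoothTransition =ᶠ[𝓝 x] fun _ => 1 := by
      filter_upwards [lt_mem_nhds h'] with y hy
      exact Real.smoothTransition.one_of_one_le hy.le
    rw [this.deriv_eq, deriv_const]
    exact hC0
  · exact (le_abs_self _).trans (hC x ⟨h, h'⟩)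

/-- An exact translation near the boundary makes the glued bicollar smooth; being the identity far
out lets the push along a collar extend by the identity. -/
lemma exists_shift : ∃ (σ : ℝ → ℝ) (R : ℝ), 0 ≤ R ∧ ContDiff ℝ ∞ σ ∧ (∀ t, 0 < deriv σ t) ∧
    (∀ t ≤ 1, σ t = 1 + t) ∧ ∀ t, R ≤ t → σ t = t := by
  obtain ⟨C, hC⟩ := exists_bound_deriv_smoothTransition
  -- Stretching the transition by a factor `B` larger than its slope keeps the derivative `1 - τ' /
  -- B` positive. The transition is complete on `[1, 1 + B]`, whence the radius `R = 1 + B`.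
  set B : ℝ := |C| + 1 with hB
  have hBpos : 0 < B := by positivity
  have hs : ContDiff ℝ ∞ Real.smoothTransition := Real.smoothTransition.contDiff (n := ⊤)
  refine ⟨fun t => t + Real.smoothTransition (1 + (1 - t) / B), 1 + B, by positivity, by fun_prop,
    fun t => ?_, fun t ht => ?_, fun t ht => ?_⟩
  · have h1 : HasDerivAt (fun t : ℝ => 1 + (1 - t) / B) (-1 / B) t :=
      (((hasDerivAt_id t).const_sub 1).div_const B).const_add 1
    have h2 := ((hs.differentiable (by simp)) (1 + (1 - t) / B)).hasDerivAt.comp t h1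
    have h3 := (hasDerivAt_id t).add h2
    have h4 : deriv (fun t => t + Real.smoothTransition (1 + (1 - t) / B)) t = _ := h3.deriv
    rw [h4]
    have h5 : deriv Real.smoothTransition (1 + (1 - t) / B) / B < 1 := by
      rw [div_lt_one hBpos]
      exact (hC _).trans_lt ((le_abs_self C).trans_lt (lt_add_one _))
    rw [neg_div, mul_neg, mul_one_div]
    linarith
  · have : (1 : ℝ) ≤ 1 + (1 - t) / B := by
      have : 0 ≤ (1 - t) / B := div_nonneg (by linarith) hBpos.le
      linarith
    simp only [Real.smoothTransition.one_of_one_le this]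
    ring
  · have : 1 + (1 - t) / B ≤ 0 := by
      have : (1 - t) / B ≤ -1 := by
        rw [div_le_iff₀ hBpos]
        linarith
      linarith
    simp only [Real.smoothTransition.zero_of_nonpos this, add_zero]

/-! ### The half-line -/

/-- The coordinate of the half-line. -/
def halfLineCoord (t : EuclideanHalfSpace 1) : ℝ := t.val 0

/-- The point of the half-line with a given coordinate. -/
def halfLineMk (r : ℝ) (h : 0 ≤ r) : EuclideanHalfSpace 1 := ⟨WithLp.toLp 2 fun _ => r, h⟩

@[simp]
lemma halfLineCoord_zero : halfLineCoord 0 = 0 := rfl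

lemma halfLineCoord_nonneg (t : EuclideanHalfSpace 1) : 0 ≤ halfLineCoord t := t.2

lemma halfLineCoord_injective : Function.Injective halfLineCoord := by
  intro s t h
  refine Subtype.ext ?_
  ext i
  rw [Subsingleton.elim i 0]
  exact h

lemma toLp_halfLineCoord (t : EuclideanHalfSpace 1) :
    (WithLp.toLp 2 fun _ => halfLineCoord t : EuclideanSpace ℝ (Fin 1)) = t.val := by
  ext i
  rw [Subsingleton.elim i 0]
  rfl

lemma contMDiff_halfLineCoord : ContMDiff (𝓡∂ 1) 𝓘(ℝ, ℝ) ∞ halfLineCoord := by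
  have h : ContDiff ℝ ∞ (fun z : EuclideanSpace ℝ (Fin 1) => z 0) := by fun_prop
  exact h.contMDiff.comp (𝓡∂ 1).contMDiff

/-! ### Smooth maps into the half-line -/

section ToHalfLine

variable {E H M : Type} [NormedAddCommGroup E] [NormedSpace ℝ E] [TopologicalSpace H]
  [TopologicalSpace M] [ChartedSpace H M] {I : ModelWithCorners ℝ E H}

lemma contDiff_toLp_const :
    ContDiff ℝ ∞ (fun r : ℝ => (WithLp.toLp 2 fun _ => r : EuclideanSpace ℝ (Fin 1))) :=
  contDiff_euclidean.2 fun _ => contDiff_id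

/-- The half-line is embedded in `ℝ¹` by its extended chart, so the coordinate alone detects
smoothness. -/
lemma contMDiffOn_halfLine {f : M → EuclideanHalfSpace 1} {s : Set M}
    (h : ContMDiffOn I 𝓘(ℝ, ℝ) ∞ (fun x => halfLineCoord (f x)) s) :
    ContMDiffOn I (𝓡∂ 1) ∞ f s := by
  have h1 : ContMDiffOn I 𝓘(ℝ, EuclideanSpace ℝ (Fin 1)) ∞ (fun x => (f x).val) s := by
    refine (contDiff_toLp_const.contMDiff.comp_contMDiffOn h).congr fun x _ => ?_
    exact (toLp_halfLineCoord _).symm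
  intro x hx
  rw [contMDiffWithinAt_iff_target]
  refine ⟨?_, (h1 x hx)⟩
  exact Topology.IsInducing.subtypeVal.continuousWithinAt_iff.2 (h1 x hx).continuousWithinAt

lemma contMDiff_halfLine {f : M → EuclideanHalfSpace 1}
    (h : ContMDiff I 𝓘(ℝ, ℝ) ∞ (fun x => halfLineCoord (f x))) :
    ContMDiff I (𝓡∂ 1) ∞ f :=
  contMDiffOn_univ.1 (contMDiffOn_halfLine h.contMDiffOn)

end ToHalfLine

/-! ### Injectivity of differentials -/

lemma mfderiv_injective_of_comp {E E' E'' H H' H'' M N P : Type}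
    [NormedAddCommGroup E] [NormedSpace ℝ E] [NormedAddCommGroup E'] [NormedSpace ℝ E']
    [NormedAddCommGroup E''] [NormedSpace ℝ E''] [TopologicalSpace H] [TopologicalSpace H']
    [TopologicalSpace H''] [TopologicalSpace M] [TopologicalSpace N] [TopologicalSpace P]
    [ChartedSpace H M] [ChartedSpace H' N] [ChartedSpace H'' P] {I : ModelWithCorners ℝ E H}
    {I' : ModelWithCorners ℝ E' H'} {I'' : ModelWithCorners ℝ E'' H''} {f : M → N} {g : N → P}
    {x : M} (hg : MDifferentiableAt I' I'' g (f x)) (hf : MDifferentiableAt I I' f x)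
    (h : Function.Injective (mfderiv I I'' (fun y => g (f y)) x)) :
    Function.Injective (mfderiv I I' f x) := by
  have e := mfderiv_comp x hg hf
  intro v w hvw
  refine h ?_
  have e' : mfderiv I I'' (fun y => g (f y)) x = (mfderiv I' I'' g (f x)).comp _ := e
  rw [e']
  exact congrArg (mfderiv I' I'' g (f x)) hvw

lemma mfderiv_injective_comp {E E' E'' H H' H'' M N P : Type}
    [NormedAddCommGroup E] [NormedSpace ℝ E] [NormedAddCommGroup E'] [NormedSpace ℝ E']
    [NormedAddCommGroup E''] [NormedSpace ℝ E''] [TopologicalSpace H] [TopologicalSpace H']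
    [TopologicalSpace H''] [TopologicalSpace M] [TopologicalSpace N] [TopologicalSpace P]
    [ChartedSpace H M] [ChartedSpace H' N] [ChartedSpace H'' P] {I : ModelWithCorners ℝ E H}
    {I' : ModelWithCorners ℝ E' H'} {I'' : ModelWithCorners ℝ E'' H''} {f : M → N} {g : N → P}
    {x : M} (hg : MDifferentiableAt I' I'' g (f x)) (hf : MDifferentiableAt I I' f x)
    (h : Function.Injective (mfderiv I' I'' g (f x)))
    (h' : Function.Injective (mfderiv I I' f x)) :
    Function.Injective (mfderiv I I'' (fun y => g (f y)) x) := by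
  have e : mfderiv I I'' (fun y => g (f y)) x = (mfderiv I' I'' g (f x)).comp _ :=
    mfderiv_comp x hg hf
  rw [e]
  exact h.comp h'

/-- Followed by `ℝ ≅ ℝ¹`, the coordinate is the extended chart, whose differential is invertible. -/
lemma mfderiv_halfLineCoord_injective (t : EuclideanHalfSpace 1) :
    Function.Injective (mfderiv (𝓡∂ 1) 𝓘(ℝ, ℝ) halfLineCoord t) := by
  refine mfderiv_injective_of_comp (I'' := 𝓘(ℝ, EuclideanSpace ℝ (Fin 1)))
    (g := fun r : ℝ => (WithLp.toLp 2 fun _ => r : EuclideanSpace ℝ (Fin 1)))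
    (contDiff_toLp_const.contMDiff.mdifferentiableAt (by simp))
    (contMDiff_halfLineCoord.mdifferentiableAt (by simp)) ?_
  have h : (fun t => (WithLp.toLp 2 fun _ => halfLineCoord t : EuclideanSpace ℝ (Fin 1))) =
      extChartAt (𝓡∂ 1) t := by
    funext s
    exact toLp_halfLineCoord s
  rw [h]
  exact (isInvertible_mfderiv_extChartAt (mem_extChartAt_source t)).injective

/-- The inclusion of the interval into the half-line. -/
def iccToHalfLine (s : Set.Icc (0 : ℝ) 1) : EuclideanHalfSpace 1 := halfLineMk s.val s.2.1

lemma contMDiff_iccToHalfLine : ContMDiff (𝓡∂ 1) (𝓡∂ 1) ∞ iccToHalfLine :=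
  contMDiff_halfLine contMDiff_subtypeVal_Icc

/-- The coordinate of this map is the inclusion of the interval in `ℝ`. Its differential sends the
unit tangent vector to `1`, and the tangent space is one-dimensional. -/
lemma mfderiv_iccToHalfLine_injective (s : Set.Icc (0 : ℝ) 1) :
    Function.Injective (mfderiv (𝓡∂ 1) (𝓡∂ 1) iccToHalfLine s) := by
  refine mfderiv_injective_of_comp (g := halfLineCoord) (I'' := 𝓘(ℝ, ℝ))
    (contMDiff_halfLineCoord.mdifferentiableAt (by simp))
    (contMDiff_iccToHalfLine.mdifferentiableAt (by simp)) ?_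
  have h1 : mfderiv (𝓡∂ 1) 𝓘(ℝ, ℝ) (fun s : Set.Icc (0 : ℝ) 1 => s.val) s 1 = (1 : ℝ) :=
    mfderiv_subtypeVal_Icc_one s
  have h2 : (1 : TangentSpace (𝓡∂ 1) s) ≠ 0 := by
    intro h
    rw [h, map_zero] at h1
    exact zero_ne_one (α := ℝ) h1
  have h3 : Module.finrank ℝ (TangentSpace (𝓡∂ 1) s) = 1 := finrank_euclideanSpace_fin (n := 1)
  refine (injective_iff_map_eq_zero _).2 fun v hv => ?_
  obtain ⟨c, rfl⟩ := (finrank_eq_one_iff_of_nonzero' _ h2).1 h3 v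
  have h4 : mfderiv (𝓡∂ 1) 𝓘(ℝ, ℝ) (fun s : Set.Icc (0 : ℝ) 1 => s.val) s (c • 1) = (0 : ℝ) := hv
  rw [map_smul, h1] at h4
  have h5 : c = 0 := (mul_one c).symm.trans h4
  rw [h5, zero_smul]

/-! ### Local diffeomorphisms between one-dimensional manifolds and their products -/

section ProductMaps

variable {E E' E'' H H' H'' S M N : Type}
  [NormedAddCommGroup E] [NormedSpace ℝ E] [NormedAddCommGroup E'] [NormedSpace ℝ E']
  [NormedAddCommGroup E''] [NormedSpace ℝ E''] [TopologicalSpace H] [TopologicalSpace H']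
  [TopologicalSpace H''] [TopologicalSpace S] [TopologicalSpace M] [TopologicalSpace N]
  [ChartedSpace H S] [ChartedSpace H' M] [ChartedSpace H'' N] {I : ModelWithCorners ℝ E H}
  {J : ModelWithCorners ℝ E' H'} {J' : ModelWithCorners ℝ E'' H''}

variable (S I) in
lemma isLocalDiffeomorph_prodMap_of_inverse {f : M → N} {g : N → M} {U : Set N} (hU : IsOpen U)
    (hf : ContMDiff J J' ∞ f) (hg : ContMDiffOn J' J ∞ g U) (hm : ∀ x, f x ∈ U)
    (hl : ∀ x, g (f x) = x) (hr : ∀ y ∈ U, f (g y) = y) :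
    IsLocalDiffeomorph (I.prod J) (I.prod J') ∞ (fun p : S × M => (p.1, f p.2)) := by
  let Φ : PartialDiffeomorph (I.prod J) (I.prod J') (S × M) (S × N) ∞ :=
    { toFun := fun p => (p.1, f p.2)
      invFun := fun p => (p.1, g p.2)
      source := Set.univ
      target := Set.univ ×ˢ U
      map_source' := fun p _ => ⟨Set.mem_univ _, hm _⟩
      map_target' := fun _ _ => Set.mem_univ _
      left_inv' := fun p _ => Prod.ext rfl (hl _)
      right_inv' := fun p hp => Prod.ext rfl (hr _ hp.2)
      open_source := isOpen_univ
      open_target := isOpen_univ.prod hU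
      contMDiffOn_toFun := (contMDiff_fst.prodMk (hf.comp contMDiff_snd)).contMDiffOn
      contMDiffOn_invFun := contMDiff_fst.contMDiffOn.prodMk
        (hg.comp contMDiff_snd.contMDiffOn fun p hp => hp.2) }
  exact fun p => ⟨Φ, Set.mem_univ _, fun _ _ => rfl⟩

variable (I) in
lemma mfderiv_prodMap_injective {f : M → N} {p : S × M} (hf : MDifferentiableAt J J' f p.2)
    (h : Function.Injective (mfderiv J J' f p.2)) :
    Function.Injective
      (mfderiv (I.prod J) (I.prod J') (fun p : S × M => (p.1, f p.2)) p) := by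
  have e : mfderiv (I.prod J) (I.prod J') (fun p : S × M => (p.1, f p.2)) p =
      (mfderiv I I id p.1).prodMap (mfderiv J J' f p.2) :=
    mfderiv_prodMap (mdifferentiableAt_id (x := p.1)) hf
  rw [e, mfderiv_id]
  exact Function.injective_id.prodMap h

end ProductMaps

/-! ### Compressing the line into an interval -/

/-- A diffeomorphism from the line to the interval `(-1,1)`. -/
abbrev squash : OpenPartialHomeomorph ℝ ℝ := OpenPartialHomeomorph.univUnitBall

lemma squash_apply (t : ℝ) : squash t = (√(1 + ‖t‖ ^ 2))⁻¹ * t := rfl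

lemma squash_symm_apply (t : ℝ) : squash.symm t = (√(1 - ‖t‖ ^ 2))⁻¹ * t := rfl

lemma squash_zero : squash 0 = 0 := OpenPartialHomeomorph.univUnitBall_apply_zero

/-- Oddness lets the collars `t ↦ 1 - squash t` and `t ↦ 1 + squash t` on the two sides of the seam
form one bicollar. -/
lemma squash_neg (t : ℝ) : squash (-t) = -squash t := by
  rw [squash_apply, squash_apply, norm_neg, mul_neg]

lemma squash_nonneg {t : ℝ} (h : 0 ≤ t) : 0 ≤ squash t := by
  rw [squash_apply]
  positivity

lemma squash_symm_nonneg {t : ℝ} (h : 0 ≤ t) : 0 ≤ squash.symm t := by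
  rw [squash_symm_apply]
  positivity

lemma abs_squash_lt (t : ℝ) : |squash t| < 1 := by
  have := squash.map_source (x := t) (Set.mem_univ _)
  rwa [OpenPartialHomeomorph.univUnitBall_target, mem_ball_zero_iff] at this

lemma squash_symm_squash (t : ℝ) : squash.symm (squash t) = t :=
  squash.left_inv (Set.mem_univ _)

lemma squash_squash_symm {t : ℝ} (h : |t| < 1) : squash (squash.symm t) = t :=
  squash.right_inv (by rwa [OpenPartialHomeomorph.univUnitBall_target, mem_ball_zero_iff])

lemma contMDiff_squash : ContMDiff 𝓘(ℝ, ℝ) 𝓘(ℝ, ℝ) ∞ squash :=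
  OpenPartialHomeomorph.contDiff_univUnitBall.contMDiff

lemma contMDiffOn_squash_symm :
    ContMDiffOn 𝓘(ℝ, ℝ) 𝓘(ℝ, ℝ) ∞ squash.symm {r | |r| < 1} := by
  refine (OpenPartialHomeomorph.contDiffOn_univUnitBall_symm.contMDiffOn).mono fun r hr => ?_
  rwa [mem_ball_zero_iff]

/-- The map `t ↦ squash t` from `[0,∞)` to itself. -/
def shrinkHalfLine (t : EuclideanHalfSpace 1) : EuclideanHalfSpace 1 :=
  halfLineMk (squash (halfLineCoord t)) (squash_nonneg (halfLineCoord_nonneg t))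

/-- The map `t ↦ 1 - squash t` from `[0,∞)` to `[0,1]`. -/
def halfLineToIcc (t : EuclideanHalfSpace 1) : Set.Icc (0 : ℝ) 1 :=
  ⟨1 - squash (halfLineCoord t), sub_nonneg.2 (abs_lt.1 (abs_squash_lt _)).2.le,
    sub_le_self _ (squash_nonneg (halfLineCoord_nonneg t))⟩

/-- The map `t ↦ 1 + squash t` from `ℝ` to `[0,∞)`. -/
def lineToHalfLine (t : ℝ) : EuclideanHalfSpace 1 :=
  halfLineMk (1 + squash t) (by linarith [(abs_lt.1 (abs_squash_lt t)).1])

lemma halfLineToIcc_zero : halfLineToIcc 0 = 1 := by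
  refine Subtype.ext ?_
  change 1 - squash 0 = 1
  rw [squash_zero, sub_zero]

lemma shrinkHalfLine_zero : shrinkHalfLine 0 = 0 := by
  refine halfLineCoord_injective ?_
  change squash 0 = 0
  exact squash_zero

lemma halfLineToIcc_injective : Function.Injective halfLineToIcc := by
  intro s t h
  have h1 : 1 - squash (halfLineCoord s) = 1 - squash (halfLineCoord t) :=
    congrArg Subtype.val h
  have h2 := congrArg squash.symm (sub_right_injective h1)
  rw [squash_symm_squash, squash_symm_squash] at h2
  exact halfLineCoord_injective h2

lemma shrinkHalfLine_injective : Function.Injective shrinkHalfLine := by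
  intro s t h
  have h1 : squash (halfLineCoord s) = squash (halfLineCoord t) := congrArg halfLineCoord h
  have h2 := congrArg squash.symm h1
  rw [squash_symm_squash, squash_symm_squash] at h2
  exact halfLineCoord_injective h2

/-! ### The collars and the bicollar of the seam -/

section Collars

variable {E H S : Type} [NormedAddCommGroup E] [NormedSpace ℝ E] [TopologicalSpace H]
  [TopologicalSpace S] [ChartedSpace H S] {I : ModelWithCorners ℝ E H}

lemma isLocalDiffeomorph_shrinkHalfLine :
    IsLocalDiffeomorph (I.prod (𝓡∂ 1)) (I.prod (𝓡∂ 1)) ∞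
      (fun p : S × EuclideanHalfSpace 1 => (p.1, shrinkHalfLine p.2)) := by
  refine isLocalDiffeomorph_prodMap_of_inverse S I (f := shrinkHalfLine)
    (g := fun r => halfLineMk (squash.symm (halfLineCoord r))
      (squash_symm_nonneg (halfLineCoord_nonneg r)))
    (U := {r | |halfLineCoord r| < 1})
    (isOpen_lt contMDiff_halfLineCoord.continuous.abs continuous_const)
    (contMDiff_halfLine (contMDiff_squash.comp contMDiff_halfLineCoord))
    (contMDiffOn_halfLine (contMDiffOn_squash_symm.comp contMDiff_halfLineCoord.contMDiffOn
      fun r hr => hr))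
    (fun t => abs_squash_lt _) (fun t => halfLineCoord_injective ?_)
    fun r hr => halfLineCoord_injective ?_
  · exact squash_symm_squash _
  · exact squash_squash_symm hr

lemma isLocalDiffeomorph_lineToHalfLine :
    IsLocalDiffeomorph (I.prod 𝓘(ℝ, ℝ)) (I.prod (𝓡∂ 1)) ∞
      (fun p : S × ℝ => (p.1, lineToHalfLine p.2)) := by
  have h1 : ContMDiff (𝓡∂ 1) 𝓘(ℝ, ℝ) ∞ (fun r => halfLineCoord r - 1) :=
    contMDiff_halfLineCoord.sub contMDiff_const
  refine isLocalDiffeomorph_prodMap_of_inverse S I (f := lineToHalfLine)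
    (g := fun r => squash.symm (halfLineCoord r - 1))
    (U := {r | |halfLineCoord r - 1| < 1})
    (isOpen_lt h1.continuous.abs continuous_const)
    (contMDiff_halfLine (contMDiff_const.add contMDiff_squash))
    (contMDiffOn_squash_symm.comp h1.contMDiffOn fun r hr => hr)
    (fun t => ?_) (fun t => ?_) fun r hr => halfLineCoord_injective ?_
  · change |1 + squash t - 1| < 1
    rw [add_sub_cancel_left]
    exact abs_squash_lt _
  · change squash.symm (1 + squash t - 1) = t
    rw [add_sub_cancel_left]
    exact squash_symm_squash _
  · change 1 + squash (squash.symm (halfLineCoord r - 1)) = halfLineCoord r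
    rw [squash_squash_symm hr, add_sub_cancel]

lemma isLocalDiffeomorph_halfLineToIcc :
    IsLocalDiffeomorph (I.prod (𝓡∂ 1)) (I.prod (𝓡∂ 1)) ∞
      (fun p : S × EuclideanHalfSpace 1 => (p.1, halfLineToIcc p.2)) := by
  have h1 : ContMDiff (𝓡∂ 1) 𝓘(ℝ, ℝ) ∞ (fun r : Set.Icc (0 : ℝ) 1 => 1 - r.val) :=
    contMDiff_const.sub contMDiff_subtypeVal_Icc
  have h2 : ContMDiff (𝓡∂ 1) 𝓘(ℝ, ℝ) ∞ (fun t => 1 - squash (halfLineCoord t)) :=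
    contMDiff_const.sub (contMDiff_squash.comp contMDiff_halfLineCoord)
  refine isLocalDiffeomorph_prodMap_of_inverse S I (f := halfLineToIcc)
    (g := fun r => halfLineMk (squash.symm (1 - r.val)) (squash_symm_nonneg (sub_nonneg.2 r.2.2)))
    (U := {r | |1 - r.val| < 1})
    (isOpen_lt h1.continuous.abs continuous_const)
    (contMDiff_iff_comp_subtypeVal_Icc.2 ⟨h2.continuous.subtype_mk _, h2⟩)
    (contMDiffOn_halfLine (contMDiffOn_squash_symm.comp h1.contMDiffOn fun r hr => hr))
    (fun t => ?_) (fun t => halfLineCoord_injective ?_) fun r hr => Subtype.ext ?_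
  · change |1 - (1 - squash (halfLineCoord t))| < 1
    rw [sub_sub_cancel]
    exact abs_squash_lt _
  · change squash.symm (1 - (1 - squash (halfLineCoord t))) = _
    rw [sub_sub_cancel]
    exact squash_symm_squash _
  · change 1 - squash (squash.symm (1 - r.val)) = r.val
    rw [squash_squash_symm hr, sub_sub_cancel]

end Collars

/-! ### Differentials at boundary points -/

section Boundary

variable {d : ℕ} {P Q : ManifoldWithBoundary d}

/-- The zeroth coordinate of `g` is non-negative on the half-space and vanishes at `p`. It thus has
a minimum there, and its derivative is non-negative in every direction that stays in the half-space.
-/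
lemma mfderiv_zero_nonneg {g : P → Q} {p : P} (hg : MDifferentiableAt (𝓡∂ (d + 1)) (𝓡∂ (d + 1)) g p)
    (hp : (𝓡∂ (d + 1)).IsBoundaryPoint p) (hgp : (𝓡∂ (d + 1)).IsBoundaryPoint (g p))
    {v : EuclideanSpace ℝ (Fin (d + 1))} (hv : 0 ≤ v 0) :
    0 ≤ (show EuclideanSpace ℝ (Fin (d + 1)) from
      mfderiv (𝓡∂ (d + 1)) (𝓡∂ (d + 1)) g p v) 0 := by
  let E := EuclideanSpace ℝ (Fin (d + 1))
  have h1 : HasFDerivWithinAt (writtenInExtChartAt (𝓡∂ (d + 1)) (𝓡∂ (d + 1)) p g)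
      (mfderiv (𝓡∂ (d + 1)) (𝓡∂ (d + 1)) g p : E →L[ℝ] E) (Set.range (𝓡∂ (d + 1)))
      (extChartAt (𝓡∂ (d + 1)) p p) := hg.hasMFDerivAt.2
  rw [ModelWithCorners.isBoundaryPoint_iff,
    frontier_range_modelWithCornersEuclideanHalfSpace] at hp hgp
  let pr : E →L[ℝ] ℝ := EuclideanSpace.proj 0
  have h2 := pr.hasFDerivAt.comp_hasFDerivWithinAt _ h1
  have h3 : IsLocalMinOn (pr ∘ writtenInExtChartAt (𝓡∂ (d + 1)) (𝓡∂ (d + 1)) p g)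
      (Set.range (𝓡∂ (d + 1))) (extChartAt (𝓡∂ (d + 1)) p p) := by
    refine Filter.Eventually.of_forall fun z => ?_
    have e : pr (writtenInExtChartAt (𝓡∂ (d + 1)) (𝓡∂ (d + 1)) p g
        (extChartAt (𝓡∂ (d + 1)) p p)) = 0 := by
      rw [writtenInExtChartAt, Function.comp_apply, Function.comp_apply, extChartAt_to_inv]
      exact hgp.symm
    change pr _ ≤ pr _
    rw [e]
    exact (chartAt (EuclideanHalfSpace (d + 1)) (g p) _).2
  refine h3.hasFDerivWithinAt_nonneg h2 (y := v) ?_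
  refine mem_posTangentConeAt_of_segment_subset ?_
  refine (𝓡∂ (d + 1)).convex_range.segment_subset (Set.mem_range_self _) ?_
  rw [range_modelWithCornersEuclideanHalfSpace]
  change 0 ≤ (extChartAt (𝓡∂ (d + 1)) p p + v) 0
  have hp' : extChartAt (𝓡∂ (d + 1)) p p 0 = 0 := hp.symm
  rw [PiLp.add_apply, hp', zero_add]
  exact hv

/-- If an inward vector `v` had an image tangent to the boundary, then adding multiples of `v` to an
arbitrary vector would give both inequalities for its image. All images would be tangent to the
boundary, against surjectivity. -/
lemma mfderiv_zero_pos {g : P → Q} {p : P} (hg : MDifferentiableAt (𝓡∂ (d + 1)) (𝓡∂ (d + 1)) g p)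
    (hp : (𝓡∂ (d + 1)).IsBoundaryPoint p) (hgp : (𝓡∂ (d + 1)).IsBoundaryPoint (g p))
    (hinj : Function.Injective (mfderiv (𝓡∂ (d + 1)) (𝓡∂ (d + 1)) g p))
    {v : EuclideanSpace ℝ (Fin (d + 1))} (hv : 0 < v 0) :
    0 < (show EuclideanSpace ℝ (Fin (d + 1)) from
      mfderiv (𝓡∂ (d + 1)) (𝓡∂ (d + 1)) g p v) 0 := by
  let E := EuclideanSpace ℝ (Fin (d + 1))
  let D : E →L[ℝ] E := mfderiv (𝓡∂ (d + 1)) (𝓡∂ (d + 1)) g p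
  have key : ∀ w : E, 0 ≤ w 0 → 0 ≤ D w 0 := fun w hw => mfderiv_zero_nonneg hg hp hgp hw
  have hsurj : Function.Surjective D := LinearMap.injective_iff_surjective (f := D.toLinearMap).1 hinj
  refine lt_of_le_of_ne (key v hv.le) fun h0 => ?_
  have hv0 : D v 0 = 0 := h0.symm
  have hzero : ∀ w : E, D w 0 = 0 := by
    intro w
    have e1 : ∀ c : ℝ, 0 ≤ (w + c • v) 0 → 0 ≤ D w 0 := fun c hc => by
      have := key _ hc
      rwa [map_add, map_smul, PiLp.add_apply, PiLp.smul_apply, hv0, smul_zero, add_zero] at this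
    have e2 : ∀ c : ℝ, 0 ≤ (-w + c • v) 0 → D w 0 ≤ 0 := fun c hc => by
      have := key _ hc
      rw [map_add, map_neg, map_smul, PiLp.add_apply, PiLp.smul_apply, hv0, smul_zero,
        add_zero, PiLp.neg_apply] at this
      linarith
    -- These multiples of `v` cancel the zeroth coordinates of `-w` and of `w`.
    refine le_antisymm (e2 (w 0 / v 0) ?_) (e1 (-w 0 / v 0) ?_)
    · rw [PiLp.add_apply, PiLp.neg_apply, PiLp.smul_apply, smul_eq_mul,
        div_mul_cancel₀ _ hv.ne', neg_add_cancel]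
    · rw [PiLp.add_apply, PiLp.smul_apply, smul_eq_mul, div_mul_cancel₀ _ hv.ne', add_neg_cancel]
  obtain ⟨w, hw⟩ := hsurj v
  have := hzero w
  rw [hw] at this
  exact hv.ne' this

end Boundary

/-! ### Pushing a manifold off its boundary along a collar -/

/-- The image is exactly `[1,∞)`, so a collar pushed by `s` covers everything beyond the segment
`[0,1]` and meets that segment only in its end. -/
lemma exists_halfLineShift : ∃ (s : EuclideanHalfSpace 1 → EuclideanHalfSpace 1) (R : ℝ),
    0 ≤ R ∧ ContMDiff (𝓡∂ 1) (𝓡∂ 1) ∞ s ∧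
    (∀ t, Function.Injective (mfderiv (𝓡∂ 1) (𝓡∂ 1) s t)) ∧ Function.Injective s ∧
    (∀ t, halfLineCoord t ≤ 1 → halfLineCoord (s t) = 1 + halfLineCoord t) ∧
    (∀ t, R ≤ halfLineCoord t → s t = t) ∧ (∀ t, 1 ≤ halfLineCoord (s t)) ∧
    ∀ t, 1 ≤ halfLineCoord t → ∃ t', s t' = t := by
  obtain ⟨σ, R, hR, hσ, hpos, hsmall, hlarge⟩ := exists_shift
  have hmono : StrictMono σ := strictMono_of_deriv_pos hpos
  have h0 : σ 0 = 1 := by rw [hsmall 0 zero_le_one, add_zero]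
  have hone : ∀ t, 0 ≤ t → 1 ≤ σ t := fun t ht => h0 ▸ hmono.monotone ht
  let s : EuclideanHalfSpace 1 → EuclideanHalfSpace 1 := fun t =>
    halfLineMk (σ (halfLineCoord t)) (zero_le_one.trans (hone _ (halfLineCoord_nonneg t)))
  have hs : ContMDiff (𝓡∂ 1) (𝓡∂ 1) ∞ s :=
    contMDiff_halfLine (hσ.contMDiff.comp contMDiff_halfLineCoord)
  refine ⟨s, R, hR, hs, fun t => ?_, fun t t' h => ?_, fun t ht => hsmall _ ht,
    fun t ht => halfLineCoord_injective (hlarge _ ht), fun t => hone _ (halfLineCoord_nonneg t),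
    fun t ht => ?_⟩
  · refine mfderiv_injective_of_comp (g := halfLineCoord) (I'' := 𝓘(ℝ, ℝ))
      (contMDiff_halfLineCoord.mdifferentiableAt (by simp)) (hs.mdifferentiableAt (by simp)) ?_
    refine mfderiv_injective_comp (I' := 𝓘(ℝ, ℝ)) (g := σ) (f := halfLineCoord)
      (hσ.contMDiff.mdifferentiableAt (by simp))
      (contMDiff_halfLineCoord.mdifferentiableAt (by simp)) ?_ (mfderiv_halfLineCoord_injective t)
    rw [mfderiv_eq_fderiv]
    refine (injective_iff_map_eq_zero _).2 fun v hv => ?_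
    have h1 : ∀ v : ℝ, fderiv ℝ σ (halfLineCoord t) v = v * deriv σ (halfLineCoord t) :=
      fun v => by rw [fderiv_eq_smul_deriv, smul_eq_mul]
    exact (mul_eq_zero.1 ((h1 v).symm.trans hv)).resolve_right (hpos _).ne'
  · exact halfLineCoord_injective (hmono.injective (congrArg halfLineCoord h))
  -- Since `σ` fixes all numbers from `R` on, `max R t` serves as the upper end for the intermediate
  -- value theorem.
  · have h1 : halfLineCoord t ∈ Set.Icc (σ 0) (σ (max R (halfLineCoord t))) := by
      rw [h0, hlarge _ (le_max_left _ _)]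
      exact ⟨ht, le_max_right _ _⟩
    obtain ⟨r, hr, e⟩ := intermediate_value_Icc (hR.trans (le_max_left _ _))
      hσ.continuous.continuousOn h1
    exact ⟨halfLineMk r hr.1, halfLineCoord_injective e⟩

lemma isCompact_halfLineCoord_le (R : ℝ) : IsCompact {t | halfLineCoord t ≤ R} := by
  have h : Continuous fun r : Set.Icc (0 : ℝ) R => halfLineMk r.val r.2.1 := by
    refine Continuous.subtype_mk ?_ _
    exact contDiff_toLp_const.continuous.comp continuous_subtype_val
  have h1 : {t | halfLineCoord t ≤ R} = Set.range fun r : Set.Icc (0 : ℝ) R =>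
      halfLineMk r.val r.2.1 := by
    ext t
    constructor
    · intro ht
      exact ⟨⟨halfLineCoord t, halfLineCoord_nonneg t, ht⟩, halfLineCoord_injective rfl⟩
    · rintro ⟨r, rfl⟩
      exact r.2.2
  rw [h1]
  exact isCompact_range h

/-! ### Descent along local diffeomorphisms -/

section

variable {E E' E'' H H' H'' M N P : Type}
  [NormedAddCommGroup E] [NormedSpace ℝ E] [NormedAddCommGroup E'] [NormedSpace ℝ E']
  [NormedAddCommGroup E''] [NormedSpace ℝ E''] [TopologicalSpace H] [TopologicalSpace H']
  [TopologicalSpace H''] [TopologicalSpace M] [TopologicalSpace N] [TopologicalSpace P]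
  [ChartedSpace H M] [ChartedSpace H' N] [ChartedSpace H'' P] {I : ModelWithCorners ℝ E H}
  {I' : ModelWithCorners ℝ E' H'} {I'' : ModelWithCorners ℝ E'' H''}

/-- Near `c q` the map `j` is `j ∘ c` composed with a local inverse of `c`. -/
lemma contMDiffAt_of_comp_isLocalDiffeomorphAt {c : M → N} {j : N → P} {q : M}
    (hc : IsLocalDiffeomorphAt I I' ∞ c q) (h : ContMDiffAt I I'' ∞ (fun x => j (c x)) q) :
    ContMDiffAt I' I'' ∞ j (c q) := by
  obtain ⟨Φ, hq, he⟩ := hc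
  have e : c q = Φ q := he hq
  have ht : Φ q ∈ Φ.target := Φ.map_source hq
  have h1 : ContMDiffAt I' I ∞ Φ.symm (Φ q) :=
    Φ.symm.contMDiffOn.contMDiffAt (Φ.open_target.mem_nhds ht)
  have e' : Φ.symm (Φ q) = q := Φ.left_inv hq
  rw [e]
  refine ContMDiffAt.congr_of_eventuallyEq (f := fun y => j (c (Φ.symm y)))
    (ContMDiffAt.comp (g := fun x => j (c x)) _ (by rw [e']; exact h) h1) ?_
  filter_upwards [Φ.open_target.mem_nhds ht] with y hy
  have h2 : c (Φ.symm y) = Φ (Φ.symm y) := he (Φ.map_target hy)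
  have h3 : Φ (Φ.symm y) = y := Φ.right_inv hy
  rw [h2, h3]

lemma mfderiv_bijective_of_isLocalDiffeomorphAt {c : M → N} {q : M}
    (hc : IsLocalDiffeomorphAt I I' ∞ c q) : Function.Bijective (mfderiv I I' c q) := by
  have h := hc.mfderivToContinuousLinearEquiv_coe (by simp)
  rw [← h]
  exact (hc.mfderivToContinuousLinearEquiv (by simp)).bijective

lemma mfderiv_injective_of_comp_isLocalDiffeomorphAt {c : M → N} {j : N → P} {q : M}
    (hc : IsLocalDiffeomorphAt I I' ∞ c q) (hj : MDifferentiableAt I' I'' j (c q))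
    (h : Function.Injective (mfderiv I I'' (fun x => j (c x)) q)) :
    Function.Injective (mfderiv I' I'' j (c q)) := by
  have e : mfderiv I I'' (fun x => j (c x)) q = (mfderiv I' I'' j (c q)).comp _ :=
    mfderiv_comp q hj (hc.mdifferentiableAt (by simp))
  rw [e] at h
  exact Function.Injective.of_comp_right h (mfderiv_bijective_of_isLocalDiffeomorphAt hc).2

end

section Push

variable {d : ℕ} {S : ClosedManifold d} {W : ManifoldWithBoundary d}

lemma preservesOrientationAt_of_eventuallyEq_id {j : W → W} {p : W}
    (h : ∀ᶠ q in 𝓝 p, j q = q) : PreservesOrientationAt W W j p := by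
  have h1 : j =ᶠ[𝓝 p] fun x => x := h
  have h2 : mfderiv (𝓡∂ (d + 1)) (𝓡∂ (d + 1)) j p = ContinuousLinearMap.id ℝ _ :=
    h1.mfderiv_eq.trans mfderiv_id
  -- The type of the differential mentions `j p`, so the point and the differential are generalized
  -- separately before `j p = p` is substituted.
  have key : ∀ z : W, z = p → ∀ D : EuclideanSpace ℝ (Fin (d + 1)) →L[ℝ]
      EuclideanSpace ℝ (Fin (d + 1)), D = ContinuousLinearMap.id ℝ _ →
      ∀ v : Fin (d + 1) → EuclideanSpace ℝ (Fin (d + 1)),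
      orientSign (V := EuclideanSpace ℝ (Fin (d + 1))) (W.orient z) (fun i => D (v i)) =
        orientSign (V := EuclideanSpace ℝ (Fin (d + 1))) (W.orient p) v := by
    rintro z rfl D rfl v
    rfl
  exact key (j p) h.self_of_nhds _ h2

/-- The push acts by `s` on the collar coordinate and by the identity off the collar; the two agree
from `R` on. Each collar line is connected and reaches the region where `j` is the identity, which
settles the orientation. -/
lemma exists_collarPush {c : S × EuclideanHalfSpace 1 → W}
    (hc : IsLocalDiffeomorph ((𝓡 d).prod (𝓡∂ 1)) (𝓡∂ (d + 1)) ∞ c)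
    (hinj : Function.Injective c) {s : EuclideanHalfSpace 1 → EuclideanHalfSpace 1} {R : ℝ}
    (hR : 0 ≤ R)
    (hs : ContMDiff (𝓡∂ 1) (𝓡∂ 1) ∞ s)
    (hs' : ∀ t, Function.Injective (mfderiv (𝓡∂ 1) (𝓡∂ 1) s t))
    (hsR : ∀ t, R ≤ halfLineCoord t → s t = t) :
    ∃ j : W → W, OrientationPreserving W W j ∧ (∀ q, j (c q) = c (q.1, s q.2)) ∧
      ∀ p, p ∉ Set.range c → j p = p := by
  classical
  let j : W → W := fun p => if h : ∃ q, c q = p then c (h.choose.1, s h.choose.2) else p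
  have hjc : ∀ q, j (c q) = c (q.1, s q.2) := fun q => by
    have h : ∃ q', c q' = c q := ⟨q, rfl⟩
    have e : h.choose = q := hinj h.choose_spec
    simp only [j, dif_pos h, e]
  have hj : ∀ p, p ∉ Set.range c → j p = p := fun p hp => dif_neg hp
  -- `K` is compact, hence closed. So every point outside `K`, even in the closure of the collar,
  -- has a neighbourhood on which `j` is the identity.
  let K : Set W := c '' (Set.univ ×ˢ {t | halfLineCoord t ≤ R})
  have hK : IsClosed K :=
    ((isCompact_univ.prod (isCompact_halfLineCoord_le R)).image hc.contMDiff.continuous).isClosed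
  have hjK : ∀ p, p ∉ K → j p = p := fun p hp => by
    by_cases h : p ∈ Set.range c
    · obtain ⟨q, rfl⟩ := h
      have hq : R ≤ halfLineCoord q.2 := by
        by_contra h'
        exact hp ⟨q, ⟨Set.mem_univ _, (not_le.1 h').le⟩, rfl⟩
      rw [hjc, hsR _ hq]
    · exact hj p h
  have hjK' : ∀ p, p ∉ K → ∀ᶠ q in 𝓝 p, j q = q := fun p hp => by
    filter_upwards [hK.isOpen_compl.mem_nhds hp] with q hq using hjK q hq
  have hcomp : ContMDiff ((𝓡 d).prod (𝓡∂ 1)) (𝓡∂ (d + 1)) ∞ (fun q => j (c q)) := by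
    have h := hc.contMDiff.comp
      ((contMDiff_fst (M := S) (I := 𝓡 d)).prodMk (hs.comp contMDiff_snd))
    exact h.congr hjc
  have hsmooth : ContMDiff (𝓡∂ (d + 1)) (𝓡∂ (d + 1)) ∞ j := fun p => by
    by_cases h : p ∈ K
    · obtain ⟨q, -, rfl⟩ := h
      exact contMDiffAt_of_comp_isLocalDiffeomorphAt (hc q) (hcomp q)
    · exact contMDiffAt_id.congr_of_eventuallyEq (hjK' p h)
  have hmf : ∀ p, Function.Injective (mfderiv (𝓡∂ (d + 1)) (𝓡∂ (d + 1)) j p) := fun p => by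
    by_cases h : p ∈ K
    · obtain ⟨q, -, rfl⟩ := h
      refine mfderiv_injective_of_comp_isLocalDiffeomorphAt (hc q)
        (hsmooth.mdifferentiableAt (by simp)) ?_
      have e : (fun q => j (c q)) = fun q => c (q.1, s q.2) := funext hjc
      rw [e]
      exact mfderiv_injective_comp (g := c) (f := fun q : S × EuclideanHalfSpace 1 => (q.1, s q.2))
        (hc.contMDiff.mdifferentiableAt (by simp))
        (((contMDiff_fst (M := S) (I := 𝓡 d)).prodMk (hs.comp contMDiff_snd)).mdifferentiableAt
          (by simp))
        (mfderiv_bijective_of_isLocalDiffeomorphAt (hc _)).1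
        (mfderiv_prodMap_injective (𝓡 d) (hs.mdifferentiableAt (by simp)) (hs' q.2))
    · have h1 : j =ᶠ[𝓝 p] fun x => x := hjK' p h
      have h2 : mfderiv (𝓡∂ (d + 1)) (𝓡∂ (d + 1)) j p = ContinuousLinearMap.id ℝ _ :=
        h1.mfderiv_eq.trans mfderiv_id
      intro v w hvw
      rw [h2] at hvw
      exact hvw
  have hclopen := isClopen_preservesOrientationAt hsmooth hmf
  refine ⟨j, ⟨hsmooth, fun p => ?_⟩, hjc, hj⟩
  by_cases h : p ∈ K
  · obtain ⟨⟨x, t⟩, -, rfl⟩ := h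
    have hcont : Continuous fun t : EuclideanHalfSpace 1 => c (x, t) :=
      hc.contMDiff.continuous.comp (continuous_const.prodMk continuous_id)
    have h1 := hclopen.preimage hcont
    -- The point at `R + 1` lies outside `K`, where `j` is locally the identity; connectedness of
    -- the half-line carries the conclusion to `t`.
    have h2 : halfLineMk (R + 1) (by linarith) ∈
        (fun t => c (x, t)) ⁻¹' {p | PreservesOrientationAt W W j p} := by
      refine preservesOrientationAt_of_eventuallyEq_id (hjK' _ ?_)
      rintro ⟨q, hq, e⟩
      rw [hinj e] at hq
      have h3 : R + 1 ≤ R := hq.2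
      linarith
    have h4 := h1.eq_univ ⟨_, h2⟩
    have h5 : t ∈ (fun t => c (x, t)) ⁻¹' {p | PreservesOrientationAt W W j p} := by
      rw [h4]
      trivial
    exact h5
  · exact preservesOrientationAt_of_eventuallyEq_id (hjK' p h)

end Push

/-! ### Gluing a cylinder to a collared boundary -/

section CylinderGluing

variable {d : ℕ} {S U : ClosedManifold d} {N : Cobordism S U}
  {c : S × EuclideanHalfSpace 1 → N.bulk}

/-- The part of a collar that is parametrized by the cylinder. -/
def collarInclusion (c : S × EuclideanHalfSpace 1 → N.bulk) (p : (cylinder S).bulk) : N.bulk :=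
  c ((ofCylinder S p).1, iccToHalfLine (ofCylinder S p).2)

lemma contMDiff_collarInclusion
    (hc : IsLocalDiffeomorph ((𝓡 d).prod (𝓡∂ 1)) (𝓡∂ (d + 1)) ∞ c) :
    ContMDiff (𝓡∂ (d + 1)) (𝓡∂ (d + 1)) ∞ (collarInclusion c) :=
  hc.contMDiff.comp
    (((contMDiff_fst (M := S) (I := 𝓡 d)).prodMk (contMDiff_iccToHalfLine.comp contMDiff_snd)).comp
      (contMDiff_ofCylinder S))

lemma mfderiv_collarInclusion_injective
    (hc : IsLocalDiffeomorph ((𝓡 d).prod (𝓡∂ 1)) (𝓡∂ (d + 1)) ∞ c) (p : (cylinder S).bulk) :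
    Function.Injective (mfderiv (𝓡∂ (d + 1)) (𝓡∂ (d + 1)) (collarInclusion c) p) := by
  have h1 : ContMDiff ((𝓡 d).prod (𝓡∂ 1)) ((𝓡 d).prod (𝓡∂ 1)) ∞
      (fun q : S × Set.Icc (0 : ℝ) 1 => (q.1, iccToHalfLine q.2)) :=
    (contMDiff_fst (M := S) (I := 𝓡 d)).prodMk (contMDiff_iccToHalfLine.comp contMDiff_snd)
  refine mfderiv_injective_comp (g := c)
    (f := fun p => ((ofCylinder S p).1, iccToHalfLine (ofCylinder S p).2))
    (hc.contMDiff.mdifferentiableAt (by simp))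
    ((h1.comp (contMDiff_ofCylinder S)).mdifferentiableAt (by simp))
    (mfderiv_bijective_of_isLocalDiffeomorphAt (hc _)).1 ?_
  refine mfderiv_injective_comp
    (g := fun q : S × Set.Icc (0 : ℝ) 1 => (q.1, iccToHalfLine q.2))
    (f := ofCylinder S)
    (h1.mdifferentiableAt (by simp)) ((contMDiff_ofCylinder S).mdifferentiableAt (by simp))
    (mfderiv_prodMap_injective (𝓡 d) (contMDiff_iccToHalfLine.mdifferentiableAt (by simp))
      (mfderiv_iccToHalfLine_injective _)) ?_
  exact (mfderiv_bijective_of_isLocalDiffeomorphAt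
    ((cylinderDiffeomorph S).symm.isLocalDiffeomorph p)).1

lemma collarInclusion_inMap (hc : IsCollar N.inMap c) (x : S) :
    collarInclusion c ((cylinder S).inMap x) = N.inMap x := by
  rw [← hc.2.2 x]
  exact congrArg (fun t => c (x, t)) (halfLineCoord_injective rfl)

/-- The collar inclusion intertwines the two in-boundary maps and sends inward vectors to inward
vectors. A frame made of an inward vector and a boundary frame then has the same sign on both sides
by the boundary convention, and one such frame is enough. -/
lemma preservesOrientationAt_collarInclusion_inMap (hc : IsCollar N.inMap c) (x : S) :
    PreservesOrientationAt (cylinder S).bulk N.bulk (collarInclusion c)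
      ((cylinder S).inMap x) := by
  let E := EuclideanSpace ℝ (Fin (d + 1))
  let v : E := EuclideanSpace.single 0 1
  have hv : (0 : ℝ) < v 0 := by simp [v]
  let w : Fin d → EuclideanSpace ℝ (Fin d) := stdBasis d
  let p := (cylinder S).inMap x
  have hsm := contMDiff_collarInclusion hc.1
  let D : E →L[ℝ] E := mfderiv (𝓡∂ (d + 1)) (𝓡∂ (d + 1)) (collarInclusion c) p
  have hp : (𝓡∂ (d + 1)).IsBoundaryPoint p := by
    have : p ∈ (𝓡∂ (d + 1)).boundary (cylinder S).bulk := by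
      rw [(cylinder S).boundary_eq]
      exact Or.inl ⟨x, rfl⟩
    exact this
  have hip : collarInclusion c p = N.inMap x := collarInclusion_inMap hc x
  have hgp : (𝓡∂ (d + 1)).IsBoundaryPoint (collarInclusion c p) := by
    have : N.inMap x ∈ (𝓡∂ (d + 1)).boundary N.bulk := by
      rw [N.boundary_eq]
      exact Or.inl ⟨x, rfl⟩
    rw [hip]
    exact this
  have hDv : 0 < D v 0 := mfderiv_zero_pos (hsm.mdifferentiableAt (by simp)) hp hgp
    (mfderiv_collarInclusion_injective hc.1 p) hv
  have h1 := (cylinder S).orient_inMap x v w hv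
  have h2 := N.orient_inMap x (D v) w hDv
  have h3 : ∀ i, D (mfderiv (𝓡 d) (𝓡∂ (d + 1)) (cylinder S).inMap x (w i)) =
      mfderiv (𝓡 d) (𝓡∂ (d + 1)) N.inMap x (w i) := fun i => by
    have e := mfderiv_comp (I' := 𝓡∂ (d + 1)) x
      (hsm.mdifferentiableAt (x := p) (by simp))
      ((cylinder S).contMDiff_inMap.mdifferentiableAt (by simp))
    have e' : collarInclusion c ∘ (cylinder S).inMap = N.inMap :=
      funext (collarInclusion_inMap hc)
    rw [e'] at e
    exact (congrArg (fun A : EuclideanSpace ℝ (Fin d) →L[ℝ] E => A (w i)) e).symm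
  have h4 : orientSign (V := EuclideanSpace ℝ (Fin d)) (S.orient x) w ≠ 0 :=
    orientSign_basis_ne_zero (stdBasis d) _
  refine PreservesOrientationAt.of_eq (v₀ := Matrix.vecCons v fun i =>
    mfderiv (𝓡 d) (𝓡∂ (d + 1)) (cylinder S).inMap x (w i)) ?_ ?_
  · intro h
    exact h4 (h1.symm.trans h)
  · refine Eq.trans ?_ h1.symm
    refine Eq.trans ?_ h2
    have key : ∀ z : N.bulk, z = N.inMap x → ∀ v₁ v₂ : Fin (d + 1) → E, v₁ = v₂ →
        orientSign (V := E) (N.bulk.orient z) v₁ =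
          orientSign (V := E) (N.bulk.orient (N.inMap x)) v₂ := by
      rintro z rfl v₁ v₂ rfl
      rfl
    refine key _ hip _ _ ?_
    funext i
    refine Fin.cases ?_ (fun i => ?_) i
    · rfl
    · exact h3 i

/-- Orientation is preserved at the bottom of the cylinder, hence by clopenness along each segment
`{x} × [0,1]`. -/
lemma orientationPreserving_collarInclusion (hc : IsCollar N.inMap c) :
    OrientationPreserving (cylinder S).bulk N.bulk (collarInclusion c) := by
  have hsm := contMDiff_collarInclusion hc.1
  refine ⟨hsm, fun p => ?_⟩
  have hclopen := isClopen_preservesOrientationAt hsm (mfderiv_collarInclusion_injective hc.1)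
  obtain ⟨⟨x, t⟩, rfl⟩ : ∃ q, toCylinder S q = p := ⟨ofCylinder S p, rfl⟩
  have hcont : Continuous fun t : Set.Icc (0 : ℝ) 1 => toCylinder S (x, t) :=
    (contMDiff_toCylinder S).continuous.comp (continuous_const.prodMk continuous_id)
  have h1 := (hclopen.preimage hcont).eq_univ
    ⟨0, preservesOrientationAt_collarInclusion_inMap hc x⟩
  have h2 : t ∈ (fun t : Set.Icc (0 : ℝ) 1 => toCylinder S (x, t)) ⁻¹'
      {p | PreservesOrientationAt (cylinder S).bulk N.bulk (collarInclusion c) p} := by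
    exact h1.ge (Set.mem_univ t)
  exact h2

/-- Local diffeomorphisms respect boundary points, so a collar point on the boundary has collar
coordinate `0` and lies on the in-boundary. Hence the push fixes the out-boundary. -/
lemma outMap_notMem_range_collar (hc : IsCollar N.inMap c) (y : U) :
    N.outMap y ∉ Set.range c := by
  rintro ⟨⟨x, t⟩, h⟩
  have h1 : (𝓡∂ (d + 1)).IsBoundaryPoint (N.outMap y) := by
    have : N.outMap y ∈ (𝓡∂ (d + 1)).boundary N.bulk := by
      rw [N.boundary_eq]
      exact Or.inr ⟨y, rfl⟩
    exact this
  rw [← h] at h1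
  have h2 : (x, t) ∈ ((𝓡 d).prod (𝓡∂ 1)).boundary (S × EuclideanHalfSpace 1) :=
    ((hc.1 (x, t)).isBoundaryPoint_iff (by simp)).2 h1
  rw [ModelWithCorners.boundary_of_boundaryless_left] at h2
  have h3 : (𝓡∂ 1).IsBoundaryPoint t := h2.2
  rw [ModelWithCorners.isBoundaryPoint_iff,
    frontier_range_modelWithCornersEuclideanHalfSpace] at h3
  have h4 : halfLineCoord 0 = halfLineCoord t := h3
  rw [← halfLineCoord_injective h4, hc.2.2] at h
  exact N.inMap_ne_outMap x y h

/-- Gluing a cylinder to a collared in-boundary does not change a cobordism. -/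
theorem cylinder_isGluing (hc : IsCollar N.inMap c) :
    (cylinder S).IsGluing (fun x => x) N N := by
  obtain ⟨s, R, hR, hs, hs', hsinj, hsmall, hlarge, hone, hsurj⟩ := exists_halfLineShift
  obtain ⟨j, hj, hjc, hjout⟩ := exists_collarPush hc.1 hc.2.1 hR hs hs' hlarge
  have hs0 : halfLineCoord (s 0) = 1 := by
    rw [hsmall 0 zero_le_one, halfLineCoord_zero, add_zero]
  -- The push never moves a point into the collar from outside, so injectivity and intersections can
  -- be examined inside the collar.
  have hjmem : ∀ p, j p ∈ Set.range c → p ∈ Set.range c := fun p hp => by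
    by_contra h
    rw [hjout p h] at hp
    exact h hp
  refine ⟨collarInclusion c, j, orientationPreserving_collarInclusion hc, hj, ?_, ?_, ?_, ?_,
    collarInclusion_inMap hc, fun y => hjout _ (outMap_notMem_range_collar hc y), ?_⟩
  · intro p q h
    have h1 := hc.2.1 h
    exact Prod.ext (Prod.mk.inj h1).1 (Subtype.ext (congrArg halfLineCoord (Prod.mk.inj h1).2))
  · intro p q h
    by_cases hp : p ∈ Set.range c
    · obtain ⟨p, rfl⟩ := hp
      rw [hjc] at h
      obtain ⟨q, rfl⟩ := hjmem q (h ▸ ⟨_, rfl⟩)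
      rw [hjc] at h
      have h1 := hc.2.1 h
      have h2 : p.1 = q.1 := (Prod.mk.inj h1).1
      have h3 : s p.2 = s q.2 := (Prod.mk.inj h1).2
      exact congrArg c (Prod.ext h2 (hsinj h3))
    · by_cases hq : q ∈ Set.range c
      · obtain ⟨q, rfl⟩ := hq
        rw [hjc q] at h
        exact absurd (hjmem p (h ▸ ⟨_, rfl⟩)) hp
      · rwa [hjout p hp, hjout q hq] at h
  · refine Set.eq_univ_of_forall fun p => ?_
    by_cases hp : p ∈ Set.range c
    · obtain ⟨⟨x, t⟩, rfl⟩ := hp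
      rcases le_total (halfLineCoord t) 1 with h | h
      · refine Or.inl ⟨toCylinder S (x, ⟨halfLineCoord t, halfLineCoord_nonneg t, h⟩), ?_⟩
        exact congrArg (fun t => c (x, t)) (halfLineCoord_injective rfl)
      · obtain ⟨t', rfl⟩ := hsurj t h
        exact Or.inr ⟨c (x, t'), hjc _⟩
    · exact Or.inr ⟨p, hjout p hp⟩
  · intro p q
    constructor
    · intro h
      obtain ⟨⟨y, t⟩, rfl⟩ := hjmem q (h ▸ ⟨_, rfl⟩)
      obtain ⟨⟨x, r⟩, rfl⟩ : ∃ q, toCylinder S q = p := ⟨ofCylinder S p, rfl⟩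
      rw [hjc] at h
      have h1 := hc.2.1 h
      have h2 : x = y := (Prod.mk.inj h1).1
      have h3 : iccToHalfLine r = s t := (Prod.mk.inj h1).2
      have h4 : r.val = halfLineCoord (s t) := congrArg halfLineCoord h3
      -- The cylinder has collar coordinate at most `1` and the pushed copy at least `1`, so they
      -- meet only at `1`, which `s` attains only at `0`.
      have h5 : halfLineCoord (s t) = 1 := le_antisymm (h4 ▸ r.2.2) (hone t)
      have h6 : t = 0 := hsinj (halfLineCoord_injective (h5.trans hs0.symm))
      have h7 : r = 1 := Subtype.ext (h4.trans h5)
      subst h2 h6 h7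
      exact ⟨x, rfl, hc.2.2 x⟩
    · rintro ⟨x, rfl, rfl⟩
      rw [← hc.2.2 x, hjc]
      refine congrArg (fun t => c (x, t)) (halfLineCoord_injective ?_)
      exact hs0.symm
  -- The seam has collar coordinate `1`, and the bicollar is `c (x, 1 + squash t)`. Its negative
  -- half is the collar of the top of the cylinder, its positive half the pushed image of a
  -- compressed collar of `N`.
  · refine ⟨fun p => toCylinder S (p.1, halfLineToIcc p.2), fun p => c (p.1, shrinkHalfLine p.2),
      fun p => c (p.1, lineToHalfLine p.2), ⟨?_, ?_, ?_⟩, ⟨?_, ?_, ?_⟩, ?_, ?_⟩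
    · exact fun p => (isLocalDiffeomorph_halfLineToIcc p).comp (𝓡∂ (d + 1)) (cylinder S).bulk
        ((cylinderDiffeomorph S).isLocalDiffeomorph _)
    · intro p q h
      have h1 : (p.1, halfLineToIcc p.2) = (q.1, halfLineToIcc q.2) := congrArg (ofCylinder S) h
      have h2 : p.1 = q.1 := (Prod.mk.inj h1).1
      have h3 : halfLineToIcc p.2 = halfLineToIcc q.2 := (Prod.mk.inj h1).2
      exact Prod.ext h2 (halfLineToIcc_injective h3)
    · intro x
      exact congrArg (fun t => toCylinder S (x, t)) halfLineToIcc_zero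
    · exact fun p => (isLocalDiffeomorph_shrinkHalfLine p).comp (𝓡∂ (d + 1)) N.bulk (hc.1 _)
    · intro p q h
      have h1 := hc.2.1 h
      have h2 : p.1 = q.1 := (Prod.mk.inj h1).1
      have h3 : shrinkHalfLine p.2 = shrinkHalfLine q.2 := (Prod.mk.inj h1).2
      exact Prod.ext h2 (shrinkHalfLine_injective h3)
    · intro x
      refine Eq.trans ?_ (hc.2.2 x)
      exact congrArg (fun t => c (x, t)) shrinkHalfLine_zero
    · exact fun p => (isLocalDiffeomorph_lineToHalfLine p).comp (𝓡∂ (d + 1)) N.bulk (hc.1 _)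
    · intro x t
      constructor
      · refine congrArg (fun t => c (x, t)) (halfLineCoord_injective ?_)
        change 1 + squash (-halfLineCoord t) = 1 - squash (halfLineCoord t)
        rw [squash_neg, sub_eq_add_neg]
      · refine Eq.trans ?_ (hjc _).symm
        refine congrArg (fun t => c (x, t)) (halfLineCoord_injective ?_)
        -- The compressed collar has coordinates below `1`, where `s` is exactly the translation by
        -- `1`.
        exact (hsmall (shrinkHalfLine t) (abs_lt.1 (abs_squash_lt _)).2.le).symm

end CylinderGluing

/-! ### Reparametrizing the in-boundary of a cobordism -/

section Precomp

variable {d : ℕ} {S T U : ClosedManifold d}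

/-- The cobordism with the in-boundary diffeomorphism precomposed with `f`. -/
def Cobordism.precomp (M : Cobordism S T) (f : Diffeomorph (𝓡 d) (𝓡 d) S S ∞)
    (hf : OrientationPreserving S S f) : Cobordism S T where
  bulk := M.bulk
  inMap x := M.inMap (f x)
  outMap := M.outMap
  contMDiff_inMap := M.contMDiff_inMap.comp f.contMDiff
  contMDiff_outMap := M.contMDiff_outMap
  injective_inMap := M.injective_inMap.comp f.injective
  injective_outMap := M.injective_outMap
  inMap_ne_outMap x y := M.inMap_ne_outMap (f x) y
  boundary_eq := by
    rw [M.boundary_eq]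
    exact congrArg (· ∪ _) (f.surjective.range_comp M.inMap).symm
  orient_inMap x v w hv := by
    have e : mfderiv (𝓡 d) (𝓡∂ (d + 1)) (fun x => M.inMap (f x)) x =
        (mfderiv (𝓡 d) (𝓡∂ (d + 1)) M.inMap (f x)).comp (mfderiv (𝓡 d) (𝓡 d) f x) :=
      mfderiv_comp x (M.contMDiff_inMap.mdifferentiableAt (by simp))
        (f.contMDiff.mdifferentiableAt (by simp))
    rw [e]
    exact (M.orient_inMap (f x) v (fun i => mfderiv (𝓡 d) (𝓡 d) f x (w i)) hv).trans (hf.2 x w)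
  orient_outMap := M.orient_outMap

/-- The parametrization of the far in-boundary enters only the condition that `i` is compatible with
it. -/
lemma Cobordism.IsGluing.precomp {M : Cobordism S T} {N : Cobordism T U} {W : Cobordism S U}
    (h : M.IsGluing (fun x => x) N W) (f : Diffeomorph (𝓡 d) (𝓡 d) S S ∞)
    (hf : OrientationPreserving S S f) :
    (M.precomp f hf).IsGluing (fun x => x) N (W.precomp f hf) := by
  obtain ⟨i, j, h1, h2, h3, h4, h5, h6, h7, h8, h9⟩ := h
  exact ⟨i, j, h1, h2, h3, h4, h5, h6, fun x => h7 (f x), h8, h9⟩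

/-- A gluing along `f` supplies a collar parametrized through `f`; undoing `f` on the first factor
gives a collar of the original in-boundary. -/
lemma IsCollar.of_comp {W : ManifoldWithBoundary d} {φ : S → W}
    {c : S × EuclideanHalfSpace 1 → W} (f : Diffeomorph (𝓡 d) (𝓡 d) S S ∞)
    (hc : IsCollar (fun x => φ (f x)) c) :
    IsCollar φ (c ∘ f.symm.prodCongr (Diffeomorph.refl (𝓡∂ 1) (EuclideanHalfSpace 1) ∞)) := by
  let e := f.symm.prodCongr (Diffeomorph.refl (𝓡∂ 1) (EuclideanHalfSpace 1) ∞)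
  refine ⟨fun p => (e.isLocalDiffeomorph p).comp (𝓡∂ (d + 1)) W (hc.1 _),
    hc.2.1.comp e.injective, fun x => ?_⟩
  refine (hc.2.2 (f.symm x)).trans ?_
  exact congrArg φ (f.apply_symm_apply x)

end Precomp

/-! ### Cobordisms between empty manifolds -/

section Empty

variable {d : ℕ}

instance {n : ℕ} {H : Type} [TopologicalSpace H]
    {I : ModelWithCorners ℝ (EuclideanSpace ℝ (Fin n)) H} {M N : CompactOriented I} [IsEmpty M]
    [IsEmpty N] : IsEmpty (M.sum N) :=
  inferInstanceAs (IsEmpty (M ⊕ N))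

/-- A closed manifold as a cobordism between empty manifolds. -/
def ClosedBulk.cobordismOfIsEmpty (X : ClosedBulk d) (S T : ClosedManifold d) [IsEmpty S]
    [IsEmpty T] : Cobordism S T where
  bulk := X.1
  inMap := isEmptyElim
  outMap := isEmptyElim
  contMDiff_inMap x := isEmptyElim x
  contMDiff_outMap x := isEmptyElim x
  injective_inMap x := isEmptyElim x
  injective_outMap x := isEmptyElim x
  inMap_ne_outMap x := isEmptyElim x
  boundary_eq := by rw [X.2, Set.range_eq_empty, Set.range_eq_empty, Set.union_empty]
  orient_inMap x := isEmptyElim x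
  orient_outMap x := isEmptyElim x

/-- With nothing to identify, a gluing is a disjoint union and all collar conditions are vacuous. -/
lemma isGluing_of_isEmpty {S T T' U : ClosedManifold d} [IsEmpty S] [IsEmpty T] [IsEmpty T']
    [IsEmpty U] {M : Cobordism S T} (f : T → T') {N : Cobordism T' U} {W : Cobordism S U}
    (h : OrientedDiffeomorphic (M.bulk.sum N.bulk) W.bulk) : M.IsGluing f N W := by
  obtain ⟨e, he⟩ := h
  refine ⟨fun p => e (Sum.inl p), fun q => e (Sum.inr q),
    he.comp (OrientationPreserving.inl _ _), he.comp (OrientationPreserving.inr _ _),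
    e.injective.comp Sum.inl_injective, e.injective.comp Sum.inr_injective, ?_, fun p q => ?_,
    fun x => isEmptyElim x, fun x => isEmptyElim x, fun p => isEmptyElim p.1,
    fun p => isEmptyElim p.1, fun p => isEmptyElim p.1,
    ⟨fun p => isEmptyElim p.1, fun p => isEmptyElim p.1, fun x => isEmptyElim x⟩,
    ⟨fun p => isEmptyElim p.1, fun p => isEmptyElim p.1, fun x => isEmptyElim x⟩,
    fun p => isEmptyElim p.1, fun x => isEmptyElim x⟩
  · refine Set.eq_univ_of_forall fun p => ?_
    obtain ⟨q, rfl⟩ := e.surjective p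
    rcases q with q | q
    · exact Or.inl ⟨q, rfl⟩
    · exact Or.inr ⟨q, rfl⟩
  · refine ⟨fun h => absurd (e.injective h) Sum.inl_ne_inr, fun ⟨x, _⟩ => isEmptyElim x⟩

lemma isMappingCylinder_of_isEmpty {S T : ClosedManifold d} [IsEmpty S] [IsEmpty T] (f : S → T)
    (C : Cobordism S T) [IsEmpty C.bulk] : C.IsMappingCylinder f :=
  ⟨{  toFun := fun p => isEmptyElim p.1
      invFun := fun p => isEmptyElim p
      left_inv := fun p => isEmptyElim p.1
      right_inv := fun p => isEmptyElim p
      contMDiff_toFun := fun p => isEmptyElim p.1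
      contMDiff_invFun := fun p => isEmptyElim p },
    fun x => isEmptyElim x, fun x => isEmptyElim x⟩

end Empty

/-! ### The values of a TQFT on closed manifolds -/

section ClosedValue

variable {k : Type u} [Field k] {d : ℕ}

namespace TQFT

lemma map_toCobordism_unit (F : TQFT k d) (X : ClosedBulk d) :
    F.map X.toCobordism (F.unit 1) = F.closedValue X • F.unit 1 := by
  rw [← map_smul, smul_eq_mul, mul_one, closedValue, LinearEquiv.apply_symm_apply]

lemma closedValue_congr (F : TQFT k d) {X Y : ClosedBulk d}
    (h : OrientedDiffeomorphic X.1 Y.1) : F.closedValue X = F.closedValue Y := by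
  obtain ⟨f, hf⟩ := h
  unfold closedValue
  rw [F.map_equivalent X.toCobordism Y.toCobordism
    ⟨f, hf, fun x => isEmptyElim x, fun x => isEmptyElim x⟩]

lemma Iso.closedValue_eq {F G : TQFT k d} (e : F.Iso G) (X : ClosedBulk d) :
    F.closedValue X = G.closedValue X := by
  have h : ∀ a, G.unit.symm (e.app _ a) = F.unit.symm a := fun a => by
    obtain ⟨r, rfl⟩ := F.unit.surjective a
    have h1 : F.unit r = r • F.unit 1 := by rw [← map_smul, smul_eq_mul, mul_one]
    rw [h1, map_smul, map_smul, map_smul, e.app_unit, LinearEquiv.symm_apply_apply,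
      LinearEquiv.symm_apply_apply]
  rw [closedValue, closedValue, ← h, e.naturality, e.app_unit]

lemma closedValue_mul (F G : TQFT k d) (X : ClosedBulk d) :
    (F.mul G).closedValue X = F.closedValue X * G.closedValue X := by
  have h1 : (F.mul G).unit 1 = F.unit 1 ⊗ₜ[k] G.unit 1 := by
    change TensorProduct.congr F.unit G.unit ((TensorProduct.lid k k).symm 1) = _
    simp
  have h2 : (F.mul G).map X.toCobordism ((F.mul G).unit 1) =
      (F.closedValue X * G.closedValue X) • (F.mul G).unit 1 := by
    rw [h1]
    refine (TensorProduct.map_tmul (F.map X.toCobordism) (G.map X.toCobordism) _ _).trans ?_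
    rw [map_toCobordism_unit, map_toCobordism_unit, TensorProduct.smul_tmul_smul]
    rfl
  rw [closedValue, h2, map_smul, LinearEquiv.symm_apply_apply, smul_eq_mul, mul_one]

/-- The empty cobordism `C : ∅ ⊔ ∅ ⇝ ∅` is the mapping cylinder of the unit identification. The
manifold `X ⊔ Y`, regarded as a cobordism `∅ ⊔ ∅ ⇝ ∅`, factors as `X ⊔ Y` followed by `C` and as `C`
followed by `X ⊔ Y`; evaluation at the unit vectors gives the two sides. -/
lemma closedValue_sum (F : TQFT k d) (X Y : ClosedBulk d) :
    F.closedValue (X.sum Y) = F.closedValue X * F.closedValue Y := by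
  let O := CompactOriented.empty (𝓡 d)
  let C : Cobordism (O.sum O) O := ClosedBulk.empty.cobordismOfIsEmpty (O.sum O) O
  let W : Cobordism (O.sum O) O := (X.sum Y).cobordismOfIsEmpty (O.sum O) O
  have hC : IsEmpty C.bulk := inferInstanceAs (IsEmpty (CompactOriented.empty _))
  have h1 := F.map_gluing (X.toCobordism.sum Y.toCobordism) C W
    (isGluing_of_isEmpty _ (OrientedDiffeomorphic.sum_empty _))
  have h2 := F.map_gluing C (X.sum Y).toCobordism W
    (isGluing_of_isEmpty _ ((OrientedDiffeomorphic.sum_comm _ _).trans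
      (OrientedDiffeomorphic.sum_empty _)))
  have h3 : ∀ a, F.map C (F.tensor O O (F.unit 1 ⊗ₜ a)) = a :=
    F.unit_tensor C (isMappingCylinder_of_isEmpty _ C)
  have h4 := LinearMap.congr_fun (h1.symm.trans h2) (F.tensor O O (F.unit 1 ⊗ₜ F.unit 1))
  rw [LinearMap.comp_apply, LinearMap.comp_apply, h3, F.map_sum, map_toCobordism_unit,
    map_toCobordism_unit, map_toCobordism_unit, TensorProduct.smul_tmul_smul, map_smul, map_smul,
    h3] at h4
  have h5 := congrArg F.unit.symm h4
  rw [map_smul, map_smul, LinearEquiv.symm_apply_apply, smul_eq_mul, smul_eq_mul, mul_one,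
    mul_one] at h5
  exact h5.symm

/-- The value of the empty manifold is spanned by `F.unit 1`, so an endomorphism is determined by
its scalar; and a cobordism from `∅` to `∅` is equivalent to the one given by its bulk. -/
lemma isTrivialOnClosed_iff (F : TQFT k d) :
    F.IsTrivialOnClosed ↔ ∀ X : ClosedBulk d, F.closedValue X = 1 := by
  constructor
  · intro h X
    rw [closedValue, h X.toCobordism, LinearMap.id_apply, LinearEquiv.symm_apply_apply]
  · intro h M
    have hM : (𝓡∂ (d + 1)).boundary M.bulk = ∅ := by
      rw [M.boundary_eq, Set.range_eq_empty, Set.range_eq_empty, Set.union_empty]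
    let X : ClosedBulk d := ⟨M.bulk, hM⟩
    have e : F.map M = F.map X.toCobordism := F.map_equivalent _ _
      ⟨Diffeomorph.refl _ _ _, OrientationPreserving.id _, fun x => isEmptyElim x,
        fun x => isEmptyElim x⟩
    ext a
    obtain ⟨r, rfl⟩ := F.unit.surjective a
    have h1 : F.unit r = r • F.unit 1 := by rw [← map_smul, smul_eq_mul, mul_one]
    rw [e, h1, map_smul, map_toCobordism_unit, h, one_smul, LinearMap.id_apply]

/-- Endomorphisms of the values of an invertible TQFT are scalars. -/
lemma exists_smul_of_iso {F G : TQFT k d} (e : (F.mul G).Iso (TQFT.trivial k d))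
    {S : ClosedManifold d} (A : F.obj S →ₗ[k] F.obj S) : ∃ r : k, ∀ a, A a = r • a := by
  have e' : F.obj S ⊗[k] G.obj S ≃ₗ[k] k := e.app S
  -- A module with a tensor inverse is invertible, and over a field this means dimension one.
  have := Module.Invertible.left e'
  have h : Module.finrank k (F.obj S) = 1 := Module.Invertible.finrank_eq_one k (F.obj S)
  obtain ⟨v, -, hv⟩ := finrank_eq_one_iff'.1 h
  obtain ⟨r, hr⟩ := hv (A v)
  refine ⟨r, fun a => ?_⟩
  obtain ⟨c, rfl⟩ := hv a
  rw [map_smul, ← hr, smul_comm]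

/-- The value on a closed gluing depends on the gluing diffeomorphism through a scalar. -/
lemma closedValue_of_isClosedGluing (F : TQFT k d) {S : ClosedManifold d}
    {X₁ : Cobordism (.empty (𝓡 d)) S} {f : Diffeomorph (𝓡 d) (𝓡 d) S S ∞}
    (hf : OrientationPreserving S S f) {X₂ : Cobordism S (.empty (𝓡 d))} {M : ClosedBulk d}
    (h : IsClosedGluing X₁ f X₂ M) {r : k}
    (hr : ∀ a, F.map ((cylinder S).precomp f hf) a = r • a) :
    F.closedValue M = r * F.unit.symm (F.map X₂ (F.map X₁ (F.unit 1))) := by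
  -- Gluing along `f` is by definition gluing along the identity to `X₂` with its in-boundary
  -- reparametrized by `f`.
  have h1 : X₁.IsGluing (fun x => x) (X₂.precomp f hf) M.toCobordism := h
  obtain ⟨-, -, -, -, -, -, -, -, -, -, -, c', -, -, hc', -⟩ := h
  -- The reparametrization is moved onto a cylinder glued in front of `X₂`; this twisted cylinder is
  -- the mapping cylinder of `f`, on which `r` depends alone.
  have h2 := ((cylinder_isGluing (N := X₂) (IsCollar.of_comp f hc')).precomp f hf)
  rw [closedValue, F.map_gluing _ _ _ h1, F.map_gluing _ _ _ h2, LinearMap.comp_apply,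
    LinearMap.comp_apply, hr, map_smul, map_smul, smul_eq_mul]

/-- Both sides contain the scalar of `f` and that of `g` once each, and the pairings of `X₁, X₂` and
of `Y₁, Y₂` once each. -/
lemma closedValue_mul_eq_of_isClosedGluing {F G : TQFT k d}
    (e : (F.mul G).Iso (TQFT.trivial k d)) {S : ClosedManifold d}
    {X₁ Y₁ : Cobordism (.empty (𝓡 d)) S} {X₂ Y₂ : Cobordism S (.empty (𝓡 d))}
    {f g : Diffeomorph (𝓡 d) (𝓡 d) S S ∞} {M N M' N' : ClosedBulk d}
    (hf : OrientationPreserving S S f) (hg : OrientationPreserving S S g)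
    (hM : IsClosedGluing X₁ f X₂ M) (hN : IsClosedGluing X₁ g X₂ N)
    (hM' : IsClosedGluing Y₁ f Y₂ M') (hN' : IsClosedGluing Y₁ g Y₂ N') :
    F.closedValue M * F.closedValue N' = F.closedValue N * F.closedValue M' := by
  obtain ⟨r, hr⟩ := exists_smul_of_iso e (F.map ((cylinder S).precomp f hf))
  obtain ⟨s, hs⟩ := exists_smul_of_iso e (F.map ((cylinder S).precomp g hg))
  rw [F.closedValue_of_isClosedGluing hf hM hr, F.closedValue_of_isClosedGluing hg hN hs,
    F.closedValue_of_isClosedGluing hf hM' hr, F.closedValue_of_isClosedGluing hg hN' hs]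
  ring

end TQFT

end ClosedValue

/-! ### The homomorphism `Ψ` -/

section Psi

variable {k : Type u} [Field k] {d : ℕ}

/-- Homomorphisms on `SKK_n` are determined by their values on closed manifolds. -/
lemma SKK.hom_ext {A : Type*} [AddCommGroup A] {φ ψ : SKK d →+ A}
    (h : ∀ X : ClosedBulk d, φ X.toSKK = ψ X.toSKK) : φ = ψ := by
  refine QuotientAddGroup.addMonoidHom_ext _ ?_
  refine Algebra.GrothendieckAddGroup.lift.symm.injective ?_
  ext x
  obtain ⟨X, rfl⟩ := Quotient.exists_rep x
  exact h X

variable (k d) in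
/-- The values of the (isomorphism classes of) TQFTs on closed manifolds. -/
def closedValueHom : TQFTClass k d →* (ClosedBulk d → k) where
  toFun := Quotient.lift (fun F X => F.closedValue X) fun _ _ ⟨e⟩ => funext e.closedValue_eq
  map_one' := rfl
  map_mul' := by
    rintro ⟨F⟩ ⟨G⟩
    exact funext (TQFT.closedValue_mul F G)

/-- The value of an invertible TQFT on a closed manifold. -/
def unitValue (X : ClosedBulk d) : InvertibleTQFTGroup k d →* kˣ :=
  Units.map ((Pi.evalMonoidHom (fun _ : ClosedBulk d => k) X).comp (closedValueHom k d))

lemma unitValue_eq {u : InvertibleTQFTGroup k d} {F : TQFT k d} (h : F.toClass = u)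
    (X : ClosedBulk d) : (unitValue X u : k) = F.closedValue X := by
  change closedValueHom k d u X = _
  rw [← h]
  rfl

lemma exists_iso_trivial {u : InvertibleTQFTGroup k d} {F : TQFT k d} (h : F.toClass = u) :
    ∃ G : TQFT k d, Nonempty ((F.mul G).Iso (TQFT.trivial k d)) := by
  obtain ⟨G, hG⟩ := Quotient.exists_rep (↑u⁻¹ : TQFTClass k d)
  refine ⟨G, Quotient.exact (s := TQFT.setoid) ?_⟩
  change F.toClass * G.toClass = 1
  rw [h, show G.toClass = (↑u⁻¹ : TQFTClass k d) from hG, Units.mul_inv]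

/-- The value of an invertible TQFT on closed manifolds, as a homomorphism on `𝕄_n`. -/
def manifoldClassHom (u : InvertibleTQFTGroup k d) : ManifoldClass d →+ Additive kˣ :=
  haveI hadd : ∀ X Y : ClosedBulk d, unitValue (X.sum Y) u = unitValue X u * unitValue Y u := by
    intro X Y
    obtain ⟨F, h⟩ := Quotient.exists_rep (u : TQFTClass k d)
    refine Units.ext ?_
    rw [Units.val_mul, unitValue_eq h, unitValue_eq h, unitValue_eq h, F.closedValue_sum]
  haveI hcongr : ∀ X Y : ClosedBulk d, OrientedDiffeomorphic X.1 Y.1 →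
      unitValue X u = unitValue Y u := by
    intro X Y hXY
    obtain ⟨F, h⟩ := Quotient.exists_rep (u : TQFTClass k d)
    refine Units.ext ?_
    rw [unitValue_eq h, unitValue_eq h, F.closedValue_congr hXY]
  { toFun := Quotient.lift (fun X => Additive.ofMul (unitValue X u)) hcongr
    map_zero' := by
      change unitValue ClosedBulk.empty u = 1
      -- From `∅ ⊔ ∅ ≅ ∅` the value is an idempotent in a group, hence `1`.
      have h := hadd ClosedBulk.empty ClosedBulk.empty
      rw [hcongr _ ClosedBulk.empty (OrientedDiffeomorphic.sum_empty _)] at h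
      exact left_eq_mul.1 h
    map_add' := by
      rintro ⟨X⟩ ⟨Y⟩
      exact hadd X Y }

/-- The value of an invertible TQFT on closed manifolds, as a homomorphism on the Grothendieck
group of `𝕄_n`. -/
def grothendieckHom (u : InvertibleTQFTGroup k d) :
    Algebra.GrothendieckAddGroup (ManifoldClass d) →+ Additive kˣ :=
  Algebra.GrothendieckAddGroup.lift (manifoldClassHom u)

lemma grothendieckHom_toGrothendieck (u : InvertibleTQFTGroup k d) (X : ClosedBulk d) :
    grothendieckHom u X.toGrothendieck = Additive.ofMul (unitValue X u) :=
  DFunLike.congr_fun (Algebra.GrothendieckAddGroup.lift.symm_apply_apply (manifoldClassHom u)) _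

/-- A generator goes to the quotient of `F(M) F(N')` by `F(N) F(M')`, which are equal because
invertibility makes the gluing diffeomorphisms act by scalars. -/
lemma relationsSKK_le_ker (u : InvertibleTQFTGroup k d) :
    relationsSKK d ≤ (grothendieckHom u).ker := by
  refine (AddSubgroup.closure_le _).2 ?_
  rintro _ ⟨S, X₁, Y₁, X₂, Y₂, f, g, M, N, M', N', hf, hg, hM, hN, hM', hN', rfl⟩
  obtain ⟨F, h⟩ := Quotient.exists_rep (u : TQFTClass k d)
  obtain ⟨G, ⟨e⟩⟩ := exists_iso_trivial h
  have h1 : unitValue M u * unitValue N' u = unitValue N u * unitValue M' u := by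
    refine Units.ext ?_
    rw [Units.val_mul, Units.val_mul, unitValue_eq h, unitValue_eq h, unitValue_eq h,
      unitValue_eq h, TQFT.closedValue_mul_eq_of_isClosedGluing e hf hg hM hN hM' hN']
  change grothendieckHom u _ = 0
  rw [map_add, map_sub, map_sub, grothendieckHom_toGrothendieck, grothendieckHom_toGrothendieck,
    grothendieckHom_toGrothendieck, grothendieckHom_toGrothendieck, sub_sub, sub_add_eq_add_sub,
    sub_eq_zero, ← ofMul_mul, ← ofMul_mul, h1]

/-- The value of an invertible TQFT on closed manifolds, as a homomorphism on `SKK_n`. -/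
def skkHom (u : InvertibleTQFTGroup k d) : SKK d →+ Additive kˣ :=
  QuotientAddGroup.lift _ (grothendieckHom u) (relationsSKK_le_ker u)

lemma skkHom_toSKK (u : InvertibleTQFTGroup k d) (X : ClosedBulk d) :
    skkHom u X.toSKK = Additive.ofMul (unitValue X u) :=
  grothendieckHom_toGrothendieck u X

lemma multiplicative_SKK_hom_ext {φ ψ : Multiplicative (SKK d) →* kˣ}
    (h : ∀ X : ClosedBulk d,
      φ (Multiplicative.ofAdd X.toSKK) = ψ (Multiplicative.ofAdd X.toSKK)) : φ = ψ :=
  AddMonoidHom.toMultiplicativeLeft.symm.injective (SKK.hom_ext h)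

variable (k d) in
/-- The homomorphism `Ψ`. -/
def psi : InvertibleTQFTGroup k d →* (Multiplicative (SKK d) →* kˣ) where
  toFun u := AddMonoidHom.toMultiplicativeLeft (skkHom u)
  map_one' := multiplicative_SKK_hom_ext fun X =>
    (congrArg Additive.toMul (skkHom_toSKK 1 X)).trans (map_one (unitValue X))
  map_mul' u v := multiplicative_SKK_hom_ext fun X =>
    (congrArg Additive.toMul (skkHom_toSKK (u * v) X)).trans <|
      (map_mul (unitValue X) u v).trans <|
        congrArg₂ (· * ·) (congrArg Additive.toMul (skkHom_toSKK u X)).symm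
          (congrArg Additive.toMul (skkHom_toSKK v X)).symm

variable (k d) in
lemma isPsi_psi : IsPsi (psi k d) := fun u F h X => by
  rw [← unitValue_eq h]
  exact congrArg (fun z => ((Additive.toMul z : kˣ) : k)) (skkHom_toSKK u X)

lemma IsPsi.eq {Ψ Ψ' : InvertibleTQFTGroup k d →* (Multiplicative (SKK d) →* kˣ)}
    (h : IsPsi Ψ) (h' : IsPsi Ψ') : Ψ = Ψ' := by
  refine MonoidHom.ext fun u => multiplicative_SKK_hom_ext fun X => Units.ext ?_
  obtain ⟨F, hF⟩ := Quotient.exists_rep (u : TQFTClass k d)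
  rw [h u F hF X, h' u F hF X]

/-- Membership on either side says that every closed value of a representative is `1`: on the left
because endomorphisms of a line are scalars, on the right because closed manifolds generate `SKK_n`.
-/
lemma IsPsi.trivialOnClosed_eq_ker
    {Ψ : InvertibleTQFTGroup k d →* (Multiplicative (SKK d) →* kˣ)} (h : IsPsi Ψ) :
    trivialOnClosed k d = Ψ.ker := by
  ext u
  rw [MonoidHom.mem_ker]
  constructor
  · intro hu
    refine multiplicative_SKK_hom_ext fun X => Units.ext ?_
    obtain ⟨F, hF⟩ := Quotient.exists_rep (u : TQFTClass k d)
    rw [h u F hF X]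
    exact F.isTrivialOnClosed_iff.1 (hu F hF) X
  · intro hu F hF
    refine F.isTrivialOnClosed_iff.2 fun X => ?_
    rw [← h u F hF X, hu]
    rfl

end Psi

end
end InvertibleTQFT

theorem mainTheorem2 (k : Type u) [Field k] (d : ℕ) :
    (∃! Ψ : InvertibleTQFT.InvertibleTQFTGroup k d →*
        (Multiplicative (InvertibleTQFT.SKK d) →* kˣ), InvertibleTQFT.IsPsi Ψ) ∧
      ∀ Ψ : InvertibleTQFT.InvertibleTQFTGroup k d →*
        (Multiplicative (InvertibleTQFT.SKK d) →* kˣ), InvertibleTQFT.IsPsi Ψ →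
          InvertibleTQFT.trivialOnClosed k d = Ψ.ker :=
  ⟨⟨InvertibleTQFT.psi k d, InvertibleTQFT.isPsi_psi k d,
    fun _ h => h.eq (InvertibleTQFT.isPsi_psi k d)⟩, fun _ h => h.trivialOnClosed_eq_ker⟩
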